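/- **Setting.** Let $\mathbb F_q$ be a finite field of characteristic different from $2$ and $3$, let $A,B\in\mathbb F_q$ be such that $f(x)=x^3+Ax+B$ has no multiple roots, and let $E$ be the elliptic curve $y^2=f(x)$, with neutral element $P_\infty$. Let $\varphi:(x,y)\mapsto(x^q,y^q)$ be the Frobenius endomorphism of $E(\mathbb F_{q^3})$ and $T_3=\{P\in E(\mathbb F_{q^3}) : P+\varphi(P)+\varphi^2(P)=P_\infty\}$. For $P\in T_3\setminus\{P_\infty\}$ let $h_P=y-(\alpha_1x+\alpha_0)$, $\alpha_1,\alpha_0\in\mathbb F_q$, be the line through $P,\varphi(P),\varphi^2(P)$ counted with multiplicity, i.e. $\mathrm{div}(h_P)=P+\varphi(P)+\varphi^2(P)-3P_\infty$; then $h_{-P}=y+(\alpha_1x+\alpha_0)$. If $P=P_\infty$, then $h_P$ denotes a nonzero constant. For $P,Q\in T_3\setminus\{P_\infty\}$, $S_{P,Q}=(S_{P,Q})_1(x)+y\,(S_{P,Q})_2(x)\in\mathbb F_q[x,y]$ is the polynomial, determined up to a nonzero constant, with $\mathrm{div}(S_{P,Q})=\sum_{0\le i,j\le 2}(\varphi^i(P)+\varphi^j(Q))-9P_\infty$.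 **Procedure 1.** Input: the coefficients of $h_P=y-(\alpha_1x+\alpha_0)$ and $h_Q=y-(\beta_1x+\beta_0)$, as elements of $\mathbb F_q$ or as indeterminates over $\mathbb F_q$. In the polynomial ring in the variables $x_{P_i},y_{P_i},x_{Q_i},y_{Q_i}$ $(1\le i\le 3)$, $x$, $y$ put $$t_i=f'(x_{P_i})x-2y_{P_i}y+(2y_{P_i}^2-f'(x_{P_i})x_{P_i}),$$ $$r_{ij}=(y_{Q_j}-y_{P_i})x+(x_{P_i}-x_{Q_j})y+\big((x_{Q_j}-x_{P_i})y_{P_i}+(y_{P_i}-y_{Q_j})x_{P_i}\big),$$ $T=\prod_{i=1}^3t_i$ and $R=\prod_{1\le i,j\le 3}r_{ij}$. In $T$ and $R$ replace $y_{P_i}$ by $\alpha_1x_{P_i}+\alpha_0$ and $y_{Q_i}$ by $\beta_1x_{Q_i}+\beta_0$; write the results as polynomials in $x$, $y$, the elementary symmetric polynomials $e_1,e_2,e_3$ of $x_{P_1},x_{P_2},x_{P_3}$ and the elementary symmetric polynomials $s_1,s_2,s_3$ of $x_{Q_1},x_{Q_2},x_{Q_3}$; then replace $e_1,e_2,e_3$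 by $\alpha_1^2,\ A-2\alpha_0\alpha_1,\ \alpha_0^2-B$ and $s_1,s_2,s_3$ by $\beta_1^2,\ A-2\beta_0\beta_1,\ \beta_0^2-B$. This gives polynomials $T(x,y)$ and $R(x,y)$. Finally recover $h_{2P}$ and $S_{P,Q}$, up to nonzero constants, from $$h_{2P}=T(x,-y)/h_{-P}^2 \bmod y^2-f(x),\qquad (S_{P,Q})_1(x)-y\,(S_{P,Q})_2(x)=R(x,y)/(h_P^3h_Q^3)\bmod y^2-f(x).$$ **Theorem (Procedure 1 is correct).** (a) *The procedure yields the formulas below.* The rewriting in elementary symmetric polynomials is possible and gives unique $T(x,y)$, $R(x,y)$. When $\alpha_1,\alpha_0,\beta_1,\beta_0$ are indeterminates over $\mathbb F_q$, there are nonzero $\kappa,\kappa'\in\mathbb F_q[\alpha_1,\alpha_0,\beta_1,\beta_0]$ such that, modulo $y^2-f(x)$, $$T(x,-y)=\kappa\,\big(y+(\alpha_1x+\alpha_0)\big)^2\big(cy-(u_0+u_1x)\big),$$ $$R(x,y)=\kappa'\,\big(y-(\alpha_1x+\alpha_0)\big)^3\big(y-(\beta_1x+\beta_0)\big)^3\Big(\sum_{i=0}^4a_ix^i-y\sum_{i=0}^3b_ix^i\Big),$$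 with $a_i,b_i,c,u_i$ given by formulas (1) and (2) below. (b) *The equalities of the procedure are correct.* Let $P,Q\in T_3\setminus\{P_\infty\}$, and run the procedure on the coefficients in $\mathbb F_q$ of $h_P$ and $h_Q$. The rewriting again gives unique $T(x,y)$, $R(x,y)$. A polynomial $g\in\mathbb F_q[x,y]$ satisfies $T(x,-y)=k\,h_{-P}^2\,g \bmod y^2-f(x)$ for some $k\in\mathbb F_q^*$ if and only if $\mathrm{div}(g)=\mathrm{div}(h_{2P})$, that is, $\mathrm{div}(g)=\sum_{i=0}^2\varphi^i(2P)-3P_\infty$. If moreover $h_P\ne h_Q$, then $g$ satisfies $R(x,y)=k\,h_P^3h_Q^3\,g(x,-y)\bmod y^2-f(x)$ for some $k\in\mathbb F_q^*$ if and only if $\mathrm{div}(g)=\mathrm{div}(S_{P,Q})$. (c) *The formulas are correct in all cases*, including $h_P=y$ and $h_Q=h_{\pm P}$. For all $P,Q\in T_3\setminus\{P_\infty\}$ with $h_P=y-(\alpha_1x+\alpha_0)$ and $h_Q=y-(\beta_1x+\beta_0)$: polynomials $s_1,s_2\in\mathbb F_q[x]$ satisfy $\mathrm{div}(s_1+ys_2)=\mathrm{div}(S_{P,Q})$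 if and only if, for some $k\in\mathbb F_q^*$, $s_1=k(a_4x^4+a_3x^3+a_2x^2+a_1x+a_0)$ and $s_2=k(b_3x^3+b_2x^2+b_1x+b_0)$, with the $a_i,b_i$ of (1). Elements $d,v_0,v_1\in\mathbb F_q$ satisfy $\mathrm{div}(dy-(v_0+v_1x))=\sum_{i=0}^2\varphi^i(2P)-3P_\infty$ if and only if $(d,v_0,v_1)=k(c,u_0,u_1)$ for some $k\in\mathbb F_q^*$, with the $c,u_0,u_1$ of (2). In particular, if $2P\ne P_\infty$, then $c\neq 0$ and $h_{2P}=y-\left(\frac{u_1}{c}x+\frac{u_0}{c}\right)$. **Formulas (1)** for the coefficients of $S_{P,Q}$: $a_4 = -\alpha_1^3\beta_1\beta_0^2 - 3B\alpha_1^3\beta_1 + 2A\alpha_1^3\beta_0 + 2\alpha_1^2\alpha_0\beta_1^2\beta_0 + A\alpha_1^2\alpha_0\beta_1 - 6B\alpha_1^2\beta_1^2 + 3A\alpha_1^2\beta_1\beta_0 + A^2\alpha_1^2 - \alpha_1\alpha_0^2\beta_1^3 + 6\alpha_1\alpha_0^2\beta_0 + 3A\alpha_1\alpha_0\beta_1^2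 + 3\alpha_1\alpha_0\beta_0^2 + 9B\alpha_1\alpha_0 - 3B\alpha_1\beta_1^3 + A\alpha_1\beta_1^2\beta_0 + 2A^2\alpha_1\beta_1 - 3\alpha_1\beta_0^3 + 9B\alpha_1\beta_0 - 3\alpha_0^3\beta_1 + 3\alpha_0^2\beta_1\beta_0 - 3A\alpha_0^2 + 2A\alpha_0\beta_1^3 + 6\alpha_0\beta_1\beta_0^2 + 9B\alpha_0\beta_1 - 6A\alpha_0\beta_0 + A^2\beta_1^2 + 9B\beta_1\beta_0 - 3A\beta_0^2$ $a_3 = 4B\alpha_1^3\beta_1^3 - 2A\alpha_1^3\beta_1^2\beta_0 + A^2\alpha_1^3\beta_1 - \alpha_1^3\beta_0^3 + 9B\alpha_1^3\beta_0 - 2A\alpha_1^2\alpha_0\beta_1^3 - \alpha_1^2\alpha_0\beta_1\beta_0^2 + 3B\alpha_1^2\alpha_0\beta_1 - 7A\alpha_1^2\alpha_0\beta_0 + A^2\alpha_1^2\beta_1^2 - 6B\alpha_1^2\beta_1\beta_0 + 3A\alpha_1^2\beta_0^2 + 6AB\alpha_1^2 - \alpha_1\alpha_0^2\beta_1^2\beta_0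 + A\alpha_1\alpha_0^2\beta_1 - 6B\alpha_1\alpha_0\beta_1^2 + 12A\alpha_1\alpha_0\beta_1\beta_0 - 8A^2\alpha_1\alpha_0 + A^2\alpha_1\beta_1^3 + 3B\alpha_1\beta_1^2\beta_0 + A\alpha_1\beta_1\beta_0^2 - 6AB\alpha_1\beta_1 + 4A^2\alpha_1\beta_0 - \alpha_0^3\beta_1^3 - 3\alpha_0^3\beta_0 + 3A\alpha_0^2\beta_1^2 + 21\alpha_0^2\beta_0^2 - 18B\alpha_0^2 + 9B\alpha_0\beta_1^3 - 7A\alpha_0\beta_1^2\beta_0 + 4A^2\alpha_0\beta_1 - 3\alpha_0\beta_0^3 + 18B\alpha_0\beta_0 + 6AB\beta_1^2 - 8A^2\beta_1\beta_0 - 18B\beta_0^2 + 4A^3 + 27B^2$ $a_2 = -A^2\alpha_1^3\beta_1^3 - 2A\alpha_1^3\beta_1\beta_0^2 - 6AB\alpha_1^3\beta_1 + A^2\alpha_1^3\beta_0 - 2A\alpha_1^2\alpha_0\beta_1^2\beta_0 + 5A^2\alpha_1^2\alpha_0\beta_1 - 3\alpha_1^2\alpha_0\beta_0^3 - 9B\alpha_1^2\alpha_0\beta_0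 + 6AB\alpha_1^2\beta_1^2 + 9B\alpha_1^2\beta_0^2 + (2A^3+ 27B^2)\alpha_1^2 - 2A\alpha_1\alpha_0^2\beta_1^3 - 3\alpha_1\alpha_0^2\beta_1\beta_0^2 + 9B\alpha_1\alpha_0^2\beta_1 + 9A\alpha_1\alpha_0^2\beta_0 + 36B\alpha_1\alpha_0\beta_1\beta_0 - 12A\alpha_1\alpha_0\beta_0^2 - 18AB\alpha_1\alpha_0 - 6AB\alpha_1\beta_1^3 + 5A^2\alpha_1\beta_1^2\beta_0 + 9B\alpha_1\beta_1\beta_0^2 + (4A^3 - 27B^2)\alpha_1\beta_1 - 3A\alpha_1\beta_0^3 + 36AB\alpha_1\beta_0 - 3\alpha_0^3\beta_1^2\beta_0 - 3A\alpha_0^3\beta_1 + 9B\alpha_0^2\beta_1^2 - 12A\alpha_0^2\beta_1\beta_0 + 6A^2\alpha_0^2 + A^2\alpha_0\beta_1^3 - 9B\alpha_0\beta_1^2\beta_0 + 9A\alpha_0\beta_1\beta_0^2 + 36AB\alpha_0\beta_1 - 24A^2\alpha_0\beta_0 + (2A^3 + 27B^2)\beta_1^2 - 18AB\beta_1\beta_0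 + 6A^2\beta_0^2$ $a_1 = -A^2\alpha_1^3\beta_1^2\beta_0 - 4B\alpha_1^3\beta_1\beta_0^2 + (A^3 - 12B^2)\alpha_1^3\beta_1 + 8AB\alpha_1^3\beta_0 - A^2\alpha_1^2\alpha_0\beta_1^3 - 4B\alpha_1^2\alpha_0\beta_1^2\beta_0 + 16AB\alpha_1^2\alpha_0\beta_1 - 3A^2\alpha_1^2\alpha_0\beta_0 + (-3A^3 + 12B^2)\alpha_1^2\beta_1^2 - 24AB\alpha_1^2\beta_1\beta_0 + 3A^2\alpha_1^2\beta_0^2 - 2A^2B\alpha_1^2 - 4B\alpha_1\alpha_0^2\beta_1^3 - 3A^2\alpha_1\alpha_0^2\beta_1 - 3\alpha_1\alpha_0^2\beta_0^3 + 15B\alpha_1\alpha_0^2\beta_0 - 24AB\alpha_1\alpha_0\beta_1^2 + 12A^2\alpha_1\alpha_0\beta_1\beta_0 - 6B\alpha_1\alpha_0\beta_0^2 - 18B^2\alpha_1\alpha_0 + (A^3 - 12B^2)\alpha_1\beta_1^3 + 16AB\alpha_1\beta_1^2\beta_0 - 3A^2\alpha_1\beta_1\beta_0^2 + 14A^2B\alpha_1\beta_1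 - 3B\alpha_1\beta_0^3 + 63B^2\alpha_1\beta_0 - 3\alpha_0^3\beta_1\beta_0^2 - 3B\alpha_0^3\beta_1 - 3A\alpha_0^3\beta_0 + 3A^2\alpha_0^2\beta_1^2 - 6B\alpha_0^2\beta_1\beta_0 + 9A\alpha_0^2\beta_0^2 + 6AB\alpha_0^2 + 8AB\alpha_0\beta_1^3 - 3A^2\alpha_0\beta_1^2\beta_0 + 15B\alpha_0\beta_1\beta_0^2 + 63B^2\alpha_0\beta_1 - 3A\alpha_0\beta_0^3 - 42AB\alpha_0\beta_0 - 2A^2B\beta_1^2 - 18B^2\beta_1\beta_0 + 6AB\beta_0^2 + 4A^4 + 27AB^2$ $a_0 = 2A^2B\alpha_1^3\beta_1 - A^3\alpha_1^3\beta_0 - A^2\alpha_1^2\alpha_0\beta_1^2\beta_0 - 4B\alpha_1^2\alpha_0\beta_1\beta_0^2 + 12B^2\alpha_1^2\alpha_0\beta_1 -4AB\alpha_1^2\alpha_0\beta_0 - 5A^2B\alpha_1^2\beta_1^2 + (A^3 - 24B^2)\alpha_1^2\beta_1\beta_0 + 6AB\alpha_1^2\beta_0^2 + (A^4 + 6AB^2)\alpha_1^2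 - 4B\alpha_1\alpha_0^2\beta_1^2\beta_0 + 2A\alpha_1\alpha_0^2\beta_1\beta_0^2 - 2AB\alpha_1\alpha_0^2\beta_1 - A^2\alpha_1\alpha_0^2\beta_0+ (A^3 - 24B^2)\alpha_1\alpha_0\beta_1^2 + 24AB\alpha_1\alpha_0\beta_1\beta_0 - 3A^2\alpha_1\alpha_0\beta_0^2 + A^2B\alpha_1\alpha_0 + 2A^2B\alpha_1\beta_1^3 + 12B^2\alpha_1\beta_1^2\beta_0 - 2AB\alpha_1\beta_1\beta_0^2 + (-2A^4 - 6AB^2)\alpha_1\beta_1 - 5A^2B\alpha_1\beta_0 - \alpha_0^3\beta_0^3 - 3B\alpha_0^3\beta_0 + 6AB\alpha_0^2\beta_1^2 - 3A^2\alpha_0^2\beta_1\beta_0 + 3B\alpha_0^2\beta_0^2 + (A^3 + 9B^2)\alpha_0^2 - A^3\alpha_0\beta_1^3 - 4AB\alpha_0\beta_1^2\beta_0 - A^2\alpha_0\beta_1\beta_0^2 - 5A^2B\alpha_0\beta_1 - 3B\alpha_0\beta_0^3 + (2A^3 - 9B^2)\alpha_0\beta_0 + (A^4 + 6AB^2)\beta_1^2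 + A^2B\beta_1\beta_0 + (A^3 + 9B^2)\beta_0^2 + 4A^3B + 27B^3$ $b_3 = \alpha_1^3\beta_0^2 - B\alpha_1^3 - 2\alpha_1^2\alpha_0\beta_1\beta_0 + A\alpha_1^2\alpha_0 + \alpha_1^2\beta_1\beta_0^2 - 3B\alpha_1^2\beta_1 + A\alpha_1^2\beta_0 + \alpha_1\alpha_0^2\beta_1^2 - 2\alpha_1\alpha_0\beta_1^2\beta_0 + 2A\alpha_1\alpha_0\beta_1 - 3B\alpha_1\beta_1^2 + 2A\alpha_1\beta_1\beta_0 + \alpha_0^3 + \alpha_0^2\beta_1^3 + 3\alpha_0^2\beta_0 + A\alpha_0\beta_1^2 + 3\alpha_0\beta_0^2 - B\beta_1^3 + A\beta_1^2\beta_0 + \beta_0^3$ $b_2 = A^2\alpha_1^3 + 3\alpha_1^2\alpha_0\beta_0^2 + 9B\alpha_1^2\alpha_0 + 3A^2\alpha_1^2\beta_1 + 3\alpha_1^2\beta_0^3 + 9B\alpha_1^2\beta_0 - 6\alpha_1\alpha_0^2\beta_1\beta_0 - 3A\alpha_1\alpha_0^2 - 6\alpha_1\alpha_0\beta_1\beta_0^2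 + 18B\alpha_1\alpha_0\beta_1 - 6A\alpha_1\alpha_0\beta_0 + 3A^2\alpha_1\beta_1^2 + 18B\alpha_1\beta_1\beta_0 - 3A\alpha_1\beta_0^2 + 3\alpha_0^3\beta_1^2 + 3\alpha_0^2\beta_1^2\beta_0 - 3A\alpha_0^2\beta_1 + 9B\alpha_0\beta_1^2 - 6A\alpha_0\beta_1\beta_0 + A^2\beta_1^3 + 9B\beta_1^2\beta_0 - 3A\beta_1\beta_0^2$ $b_1 = -A^2\alpha_1^3\beta_1^2 - 2A\alpha_1^3\beta_0^2 + 2AB\alpha_1^3 - 12B\alpha_1^2\alpha_0\beta_1^2 + 4A\alpha_1^2\alpha_0\beta_1\beta_0 - 3A^2\alpha_1^2\alpha_0 - A^2\alpha_1^2\beta_1^3 - 12B\alpha_1^2\beta_1^2\beta_0 + 4A\alpha_1^2\beta_1\beta_0^2 + A^2\alpha_1^2\beta_0 + 4A\alpha_1\alpha_0^2\beta_1^2 - 3\alpha_1\alpha_0^2\beta_0^2 - 9B\alpha_1\alpha_0^2 + 4A\alpha_1\alpha_0\beta_1^2\beta_0 + 2A^2\alpha_1\alpha_0\beta_1 + 6\alpha_1\alpha_0\beta_0^3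 + 18B\alpha_1\alpha_0\beta_0 + 2A^2\alpha_1\beta_1\beta_0 + 9B\alpha_1\beta_0^2 + (4A^3 + 27B^2)\alpha_1 + 6\alpha_0^3\beta_1\beta_0 + A\alpha_0^3 - 2A\alpha_0^2\beta_1^3 - 3\alpha_0^2\beta_1\beta_0^2 + 9B\alpha_0^2\beta_1 - 9A\alpha_0^2\beta_0 + A^2\alpha_0\beta_1^2 + 18B\alpha_0\beta_1\beta_0 - 9A\alpha_0\beta_0^2 + 2AB\beta_1^3 - 3A^2\beta_1^2\beta_0 - 9B\beta_1\beta_0^2 + (4A^3 + 27B^2)\beta_1 + A\beta_0^3$ $b_0 = -2A^2\alpha_1^3\beta_1\beta_0 - 8B\alpha_1^3\beta_0^2 + (A^3 + 8B^2)\alpha_1^3 + A^2\alpha_1^2\alpha_0\beta_1^2 - 8B\alpha_1^2\alpha_0\beta_1\beta_0 + 6A\alpha_1^2\alpha_0\beta_0^2 - 2AB\alpha_1^2\alpha_0 + A^2\alpha_1^2\beta_1^2\beta_0 + 4B\alpha_1^2\beta_1\beta_0^2 + (-A^3 - 12B^2)\alpha_1^2\beta_1 + 4AB\alpha_1^2\beta_0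 + 4B\alpha_1\alpha_0^2\beta_1^2 + A^2\alpha_1\alpha_0^2 - 2A^2\alpha_1\alpha_0\beta_1^3 - 8B\alpha_1\alpha_0\beta_1^2\beta_0 + 8AB\alpha_1\alpha_0\beta_1 - 6A^2\alpha_1\alpha_0\beta_0 + (-A^3 - 12B^2)\alpha_1\beta_1^2 + 8AB\alpha_1\beta_1\beta_0 - 3A^2\alpha_1\beta_0^2 + 3\alpha_0^3\beta_0^2 + B\alpha_0^3 - 8B\alpha_0^2\beta_1^3 + 6A\alpha_0^2\beta_1^2\beta_0 - 3A^2\alpha_0^2\beta_1 + 3\alpha_0^2\beta_0^3 - 15B\alpha_0^2\beta_0 + 4AB\alpha_0\beta_1^2 - 6A^2\alpha_0\beta_1\beta_0 - 15B\alpha_0\beta_0^2 + (4A^3 + 27B^2)\alpha_0 + (A^3 + 8B^2)\beta_1^3 - 2AB\beta_1^2\beta_0 + A^2\beta_1\beta_0^2 + B\beta_0^3 + (4A^3 + 27B^2)\beta_0$ **Formulas (2)** for the coefficients of $h_{2P}$: $u_1 = 4B\alpha_1^4 - 4A\alpha_1^3\alpha_0 + 4A^2\alpha_1^2 - 4\alpha_1\alpha_0^3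 + 36B\alpha_1\alpha_0 - 12A\alpha_0^2$ $u_0 = -A^2\alpha_1^4 - 8B\alpha_1^3\alpha_0 + 2A\alpha_1^2\alpha_0^2 + 6AB\alpha_1^2 - 8A^2\alpha_1\alpha_0 - \alpha_0^4 - 18B\alpha_0^2 + 4A^3 + 27B^2$ $c = 8B\alpha_1^3 - 8A\alpha_1^2\alpha_0 - 8\alpha_0^3$ -/

import Mathlib

open Polynomial
open scoped Polynomial.Bivariate

namespace TraceZero

/-! ## Data of the procedure -/

/-- The input of the procedure over a commutative ring `k`: the curve `y² = x³ + A x + B` and two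
lines `h_P = y - (α₁ x + α₀)`, `h_Q = y - (β₁ x + β₀)`. -/
structure LinePair (k : Type*) where
  A : k
  B : k
  α₁ : k
  α₀ : k
  β₁ : k
  β₀ : k

section Procedure

variable {k : Type*} [CommRing k]

/-- The coefficient of `S_{P,Q}` called `a₄`. -/
def a₄ : LinePair k → k := fun ⟨A, B, α₁, α₀, β₁, β₀⟩ =>
    -α₁^3 * β₁ * β₀^2 - 3 * B * α₁^3 * β₁ + 2 * A * α₁^3 * β₀ + 2 * α₁^2 * α₀ * β₁^2 * β₀ +
    A * α₁^2 * α₀ * β₁ - 6 * B * α₁^2 * β₁^2 + 3 * A * α₁^2 * β₁ * β₀ + A^2 * α₁^2 - α₁ *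
    α₀^2 * β₁^3 + 6 * α₁ * α₀^2 * β₀ + 3 * A * α₁ * α₀ * β₁^2 + 3 * α₁ * α₀ * β₀^2 + 9 * B *
    α₁ * α₀ - 3 * B * α₁ * β₁^3 + A * α₁ * β₁^2 * β₀ + 2 * A^2 * α₁ * β₁ - 3 * α₁ * β₀^3 + 9
    * B * α₁ * β₀ - 3 * α₀^3 * β₁ + 3 * α₀^2 * β₁ * β₀ - 3 * A * α₀^2 + 2 * A * α₀ * β₁^3 +
    6 * α₀ * β₁ * β₀^2 + 9 * B * α₀ * β₁ - 6 * A * α₀ * β₀ + A^2 * β₁^2 + 9 * B * β₁ * β₀ -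
    3 * A * β₀^2

/-- The coefficient of `S_{P,Q}` called `a₃`. -/
def a₃ : LinePair k → k := fun ⟨A, B, α₁, α₀, β₁, β₀⟩ =>
    4 * B * α₁^3 * β₁^3 - 2 * A * α₁^3 * β₁^2 * β₀ + A^2 * α₁^3 * β₁ - α₁^3 * β₀^3 + 9 * B *
    α₁^3 * β₀ - 2 * A * α₁^2 * α₀ * β₁^3 - α₁^2 * α₀ * β₁ * β₀^2 + 3 * B * α₁^2 * α₀ * β₁ -
    7 * A * α₁^2 * α₀ * β₀ + A^2 * α₁^2 * β₁^2 - 6 * B * α₁^2 * β₁ * β₀ + 3 * A * α₁^2 *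
    β₀^2 + 6 * A * B * α₁^2 - α₁ * α₀^2 * β₁^2 * β₀ + A * α₁ * α₀^2 * β₁ - 6 * B * α₁ * α₀ *
    β₁^2 + 12 * A * α₁ * α₀ * β₁ * β₀ - 8 * A^2 * α₁ * α₀ + A^2 * α₁ * β₁^3 + 3 * B * α₁ *
    β₁^2 * β₀ + A * α₁ * β₁ * β₀^2 - 6 * A * B * α₁ * β₁ + 4 * A^2 * α₁ * β₀ - α₀^3 * β₁^3 -
    3 * α₀^3 * β₀ + 3 * A * α₀^2 * β₁^2 + 21 * α₀^2 * β₀^2 - 18 * B * α₀^2 + 9 * B * α₀ *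
    β₁^3 - 7 * A * α₀ * β₁^2 * β₀ + 4 * A^2 * α₀ * β₁ - 3 * α₀ * β₀^3 + 18 * B * α₀ * β₀ + 6
    * A * B * β₁^2 - 8 * A^2 * β₁ * β₀ - 18 * B * β₀^2 + 4 * A^3 + 27 * B^2

/-- The coefficient of `S_{P,Q}` called `a₂`. -/
def a₂ : LinePair k → k := fun ⟨A, B, α₁, α₀, β₁, β₀⟩ =>
    -A^2 * α₁^3 * β₁^3 - 2 * A * α₁^3 * β₁ * β₀^2 - 6 * A * B * α₁^3 * β₁ + A^2 * α₁^3 * β₀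
    - 2 * A * α₁^2 * α₀ * β₁^2 * β₀ + 5 * A^2 * α₁^2 * α₀ * β₁ - 3 * α₁^2 * α₀ * β₀^3 - 9 *
    B * α₁^2 * α₀ * β₀ + 6 * A * B * α₁^2 * β₁^2 + 9 * B * α₁^2 * β₀^2 + (2 * A^3 + 27 *
    B^2) * α₁^2 - 2 * A * α₁ * α₀^2 * β₁^3 - 3 * α₁ * α₀^2 * β₁ * β₀^2 + 9 * B * α₁ * α₀^2 *
    β₁ + 9 * A * α₁ * α₀^2 * β₀ + 36 * B * α₁ * α₀ * β₁ * β₀ - 12 * A * α₁ * α₀ * β₀^2 - 18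
    * A * B * α₁ * α₀ - 6 * A * B * α₁ * β₁^3 + 5 * A^2 * α₁ * β₁^2 * β₀ + 9 * B * α₁ * β₁ *
    β₀^2 + (4 * A^3 - 27 * B^2) * α₁ * β₁ - 3 * A * α₁ * β₀^3 + 36 * A * B * α₁ * β₀ - 3 *
    α₀^3 * β₁^2 * β₀ - 3 * A * α₀^3 * β₁ + 9 * B * α₀^2 * β₁^2 - 12 * A * α₀^2 * β₁ * β₀ + 6
    * A^2 * α₀^2 + A^2 * α₀ * β₁^3 - 9 * B * α₀ * β₁^2 * β₀ + 9 * A * α₀ * β₁ * β₀^2 + 36 *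
    A * B * α₀ * β₁ - 24 * A^2 * α₀ * β₀ + (2 * A^3 + 27 * B^2) * β₁^2 - 18 * A * B * β₁ *
    β₀ + 6 * A^2 * β₀^2

/-- The coefficient of `S_{P,Q}` called `a₁`. -/
def a₁ : LinePair k → k := fun ⟨A, B, α₁, α₀, β₁, β₀⟩ =>
    -A^2 * α₁^3 * β₁^2 * β₀ - 4 * B * α₁^3 * β₁ * β₀^2 + (A^3 - 12 * B^2) * α₁^3 * β₁ + 8 *
    A * B * α₁^3 * β₀ - A^2 * α₁^2 * α₀ * β₁^3 - 4 * B * α₁^2 * α₀ * β₁^2 * β₀ + 16 * A * B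
    * α₁^2 * α₀ * β₁ - 3 * A^2 * α₁^2 * α₀ * β₀ + (-3 * A^3 + 12 * B^2) * α₁^2 * β₁^2 - 24 *
    A * B * α₁^2 * β₁ * β₀ + 3 * A^2 * α₁^2 * β₀^2 - 2 * A^2 * B * α₁^2 - 4 * B * α₁ * α₀^2
    * β₁^3 - 3 * A^2 * α₁ * α₀^2 * β₁ - 3 * α₁ * α₀^2 * β₀^3 + 15 * B * α₁ * α₀^2 * β₀ - 24
    * A * B * α₁ * α₀ * β₁^2 + 12 * A^2 * α₁ * α₀ * β₁ * β₀ - 6 * B * α₁ * α₀ * β₀^2 - 18 *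
    B^2 * α₁ * α₀ + (A^3 - 12 * B^2) * α₁ * β₁^3 + 16 * A * B * α₁ * β₁^2 * β₀ - 3 * A^2 *
    α₁ * β₁ * β₀^2 + 14 * A^2 * B * α₁ * β₁ - 3 * B * α₁ * β₀^3 + 63 * B^2 * α₁ * β₀ - 3 *
    α₀^3 * β₁ * β₀^2 - 3 * B * α₀^3 * β₁ - 3 * A * α₀^3 * β₀ + 3 * A^2 * α₀^2 * β₁^2 - 6 * B
    * α₀^2 * β₁ * β₀ + 9 * A * α₀^2 * β₀^2 + 6 * A * B * α₀^2 + 8 * A * B * α₀ * β₁^3 - 3 *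
    A^2 * α₀ * β₁^2 * β₀ + 15 * B * α₀ * β₁ * β₀^2 + 63 * B^2 * α₀ * β₁ - 3 * A * α₀ * β₀^3
    - 42 * A * B * α₀ * β₀ - 2 * A^2 * B * β₁^2 - 18 * B^2 * β₁ * β₀ + 6 * A * B * β₀^2 + 4
    * A^4 + 27 * A * B^2

/-- The coefficient of `S_{P,Q}` called `a₀`. -/
def a₀ : LinePair k → k := fun ⟨A, B, α₁, α₀, β₁, β₀⟩ =>
    2 * A^2 * B * α₁^3 * β₁ - A^3 * α₁^3 * β₀ - A^2 * α₁^2 * α₀ * β₁^2 * β₀ - 4 * B * α₁^2 *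
    α₀ * β₁ * β₀^2 + 12 * B^2 * α₁^2 * α₀ * β₁ - 4 * A * B * α₁^2 * α₀ * β₀ - 5 * A^2 * B *
    α₁^2 * β₁^2 + (A^3 - 24 * B^2) * α₁^2 * β₁ * β₀ + 6 * A * B * α₁^2 * β₀^2 + (A^4 + 6 * A
    * B^2) * α₁^2 - 4 * B * α₁ * α₀^2 * β₁^2 * β₀ + 2 * A * α₁ * α₀^2 * β₁ * β₀^2 - 2 * A *
    B * α₁ * α₀^2 * β₁ - A^2 * α₁ * α₀^2 * β₀ + (A^3 - 24 * B^2) * α₁ * α₀ * β₁^2 + 24 * A *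
    B * α₁ * α₀ * β₁ * β₀ - 3 * A^2 * α₁ * α₀ * β₀^2 + A^2 * B * α₁ * α₀ + 2 * A^2 * B * α₁
    * β₁^3 + 12 * B^2 * α₁ * β₁^2 * β₀ - 2 * A * B * α₁ * β₁ * β₀^2 + (-2 * A^4 - 6 * A *
    B^2) * α₁ * β₁ - 5 * A^2 * B * α₁ * β₀ - α₀^3 * β₀^3 - 3 * B * α₀^3 * β₀ + 6 * A * B *
    α₀^2 * β₁^2 - 3 * A^2 * α₀^2 * β₁ * β₀ + 3 * B * α₀^2 * β₀^2 + (A^3 + 9 * B^2) * α₀^2 -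
    A^3 * α₀ * β₁^3 - 4 * A * B * α₀ * β₁^2 * β₀ - A^2 * α₀ * β₁ * β₀^2 - 5 * A^2 * B * α₀ *
    β₁ - 3 * B * α₀ * β₀^3 + (2 * A^3 - 9 * B^2) * α₀ * β₀ + (A^4 + 6 * A * B^2) * β₁^2 +
    A^2 * B * β₁ * β₀ + (A^3 + 9 * B^2) * β₀^2 + 4 * A^3 * B + 27 * B^3

/-- The coefficient of `S_{P,Q}` called `b₃`. -/
def b₃ : LinePair k → k := fun ⟨A, B, α₁, α₀, β₁, β₀⟩ =>
    α₁^3 * β₀^2 - B * α₁^3 - 2 * α₁^2 * α₀ * β₁ * β₀ + A * α₁^2 * α₀ + α₁^2 * β₁ * β₀^2 - 3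
    * B * α₁^2 * β₁ + A * α₁^2 * β₀ + α₁ * α₀^2 * β₁^2 - 2 * α₁ * α₀ * β₁^2 * β₀ + 2 * A *
    α₁ * α₀ * β₁ - 3 * B * α₁ * β₁^2 + 2 * A * α₁ * β₁ * β₀ + α₀^3 + α₀^2 * β₁^3 + 3 * α₀^2
    * β₀ + A * α₀ * β₁^2 + 3 * α₀ * β₀^2 - B * β₁^3 + A * β₁^2 * β₀ + β₀^3

/-- The coefficient of `S_{P,Q}` called `b₂`. -/
def b₂ : LinePair k → k := fun ⟨A, B, α₁, α₀, β₁, β₀⟩ =>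
    A^2 * α₁^3 + 3 * α₁^2 * α₀ * β₀^2 + 9 * B * α₁^2 * α₀ + 3 * A^2 * α₁^2 * β₁ + 3 * α₁^2 *
    β₀^3 + 9 * B * α₁^2 * β₀ - 6 * α₁ * α₀^2 * β₁ * β₀ - 3 * A * α₁ * α₀^2 - 6 * α₁ * α₀ *
    β₁ * β₀^2 + 18 * B * α₁ * α₀ * β₁ - 6 * A * α₁ * α₀ * β₀ + 3 * A^2 * α₁ * β₁^2 + 18 * B
    * α₁ * β₁ * β₀ - 3 * A * α₁ * β₀^2 + 3 * α₀^3 * β₁^2 + 3 * α₀^2 * β₁^2 * β₀ - 3 * A *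
    α₀^2 * β₁ + 9 * B * α₀ * β₁^2 - 6 * A * α₀ * β₁ * β₀ + A^2 * β₁^3 + 9 * B * β₁^2 * β₀ -
    3 * A * β₁ * β₀^2

/-- The coefficient of `S_{P,Q}` called `b₁`. -/
def b₁ : LinePair k → k := fun ⟨A, B, α₁, α₀, β₁, β₀⟩ =>
    -A^2 * α₁^3 * β₁^2 - 2 * A * α₁^3 * β₀^2 + 2 * A * B * α₁^3 - 12 * B * α₁^2 * α₀ * β₁^2
    + 4 * A * α₁^2 * α₀ * β₁ * β₀ - 3 * A^2 * α₁^2 * α₀ - A^2 * α₁^2 * β₁^3 - 12 * B * α₁^2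
    * β₁^2 * β₀ + 4 * A * α₁^2 * β₁ * β₀^2 + A^2 * α₁^2 * β₀ + 4 * A * α₁ * α₀^2 * β₁^2 - 3
    * α₁ * α₀^2 * β₀^2 - 9 * B * α₁ * α₀^2 + 4 * A * α₁ * α₀ * β₁^2 * β₀ + 2 * A^2 * α₁ * α₀
    * β₁ + 6 * α₁ * α₀ * β₀^3 + 18 * B * α₁ * α₀ * β₀ + 2 * A^2 * α₁ * β₁ * β₀ + 9 * B * α₁
    * β₀^2 + (4 * A^3 + 27 * B^2) * α₁ + 6 * α₀^3 * β₁ * β₀ + A * α₀^3 - 2 * A * α₀^2 * β₁^3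
    - 3 * α₀^2 * β₁ * β₀^2 + 9 * B * α₀^2 * β₁ - 9 * A * α₀^2 * β₀ + A^2 * α₀ * β₁^2 + 18 *
    B * α₀ * β₁ * β₀ - 9 * A * α₀ * β₀^2 + 2 * A * B * β₁^3 - 3 * A^2 * β₁^2 * β₀ - 9 * B *
    β₁ * β₀^2 + (4 * A^3 + 27 * B^2) * β₁ + A * β₀^3

/-- The coefficient of `S_{P,Q}` called `b₀`. -/
def b₀ : LinePair k → k := fun ⟨A, B, α₁, α₀, β₁, β₀⟩ =>
    -2 * A^2 * α₁^3 * β₁ * β₀ - 8 * B * α₁^3 * β₀^2 + (A^3 + 8 * B^2) * α₁^3 + A^2 * α₁^2 *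
    α₀ * β₁^2 - 8 * B * α₁^2 * α₀ * β₁ * β₀ + 6 * A * α₁^2 * α₀ * β₀^2 - 2 * A * B * α₁^2 *
    α₀ + A^2 * α₁^2 * β₁^2 * β₀ + 4 * B * α₁^2 * β₁ * β₀^2 + (-A^3 - 12 * B^2) * α₁^2 * β₁ +
    4 * A * B * α₁^2 * β₀ + 4 * B * α₁ * α₀^2 * β₁^2 + A^2 * α₁ * α₀^2 - 2 * A^2 * α₁ * α₀ *
    β₁^3 - 8 * B * α₁ * α₀ * β₁^2 * β₀ + 8 * A * B * α₁ * α₀ * β₁ - 6 * A^2 * α₁ * α₀ * β₀ +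
    (-A^3 - 12 * B^2) * α₁ * β₁^2 + 8 * A * B * α₁ * β₁ * β₀ - 3 * A^2 * α₁ * β₀^2 + 3 *
    α₀^3 * β₀^2 + B * α₀^3 - 8 * B * α₀^2 * β₁^3 + 6 * A * α₀^2 * β₁^2 * β₀ - 3 * A^2 * α₀^2
    * β₁ + 3 * α₀^2 * β₀^3 - 15 * B * α₀^2 * β₀ + 4 * A * B * α₀ * β₁^2 - 6 * A^2 * α₀ * β₁
    * β₀ - 15 * B * α₀ * β₀^2 + (4 * A^3 + 27 * B^2) * α₀ + (A^3 + 8 * B^2) * β₁^3 - 2 * A *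
    B * β₁^2 * β₀ + A^2 * β₁ * β₀^2 + B * β₀^3 + (4 * A^3 + 27 * B^2) * β₀

/-- The coefficient of `h_{2P}` called `u₁`. -/
def u₁ : LinePair k → k := fun ⟨A, B, α₁, α₀, _, _⟩ =>
    4 * B * α₁^4 - 4 * A * α₁^3 * α₀ + 4 * A^2 * α₁^2 - 4 * α₁ * α₀^3 + 36 * B * α₁ * α₀ -
    12 * A * α₀^2

/-- The coefficient of `h_{2P}` called `u₀`. -/
def u₀ : LinePair k → k := fun ⟨A, B, α₁, α₀, _, _⟩ =>
    -A^2 * α₁^4 - 8 * B * α₁^3 * α₀ + 2 * A * α₁^2 * α₀^2 + 6 * A * B * α₁^2 - 8 * A^2 * α₁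
    * α₀ - α₀^4 - 18 * B * α₀^2 + 4 * A^3 + 27 * B^2

/-- The coefficient of `h_{2P}` called `c`. -/
def c : LinePair k → k := fun ⟨A, B, α₁, α₀, _, _⟩ =>
    8 * B * α₁^3 - 8 * A * α₁^2 * α₀ - 8 * α₀^3

/-- `f(x) = x³ + A x + B`. -/
noncomputable def cubic (A B : k) : k[X] := X ^ 3 + C A * X + C B

/-- The modulus `y² - f(x)`. -/
noncomputable def modulus (A B : k) : k[X][Y] := Y ^ 2 - C (cubic A B)

/-- The polynomial `y - (m₁ x + m₀)`. -/
noncomputable def line (m₁ m₀ : k) : k[X][Y] := Y - C (C m₁ * X + C m₀)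

/-- The polynomial `g(x, -y)`. -/
noncomputable def conjY (g : k[X][Y]) : k[X][Y] := g.comp (-X)

/-! ## The formulas -/

/-- `(S_{P,Q})₁ = a₄x⁴ + a₃x³ + a₂x² + a₁x + a₀`. -/
noncomputable def sumPart₁ (D : LinePair k) : k[X] :=
  C (a₄ D) * X ^ 4 + C (a₃ D) * X ^ 3 + C (a₂ D) * X ^ 2 + C (a₁ D) * X + C (a₀ D)

/-- `(S_{P,Q})₂ = b₃x³ + b₂x² + b₁x + b₀`. -/
noncomputable def sumPart₂ (D : LinePair k) : k[X] :=
  C (b₃ D) * X ^ 3 + C (b₂ D) * X ^ 2 + C (b₁ D) * X + C (b₀ D)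

/-- `S_{P,Q} = (S_{P,Q})₁ + y (S_{P,Q})₂`, as given by the formulas. -/
noncomputable def sumFormula (D : LinePair k) : k[X][Y] := C (sumPart₁ D) + Y * C (sumPart₂ D)

/-- `h_{2P} = c y - (u₀ + u₁ x)`, as given by the formulas. -/
noncomputable def doublingFormula (D : LinePair k) : k[X][Y] :=
  C (C (c D)) * Y - C (C (u₀ D) + C (u₁ D) * X)

/-! ## The procedure -/

/-- The variables `x_{P_i}, y_{P_i}, x_{Q_i}, y_{Q_i}, x, y`. -/
inductive Var
  | xP (i : Fin 3)
  | yP (i : Fin 3)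
  | xQ (i : Fin 3)
  | yQ (i : Fin 3)
  | x
  | y

/-- The variables `e_i, s_i, x, y` (indices shifted by one: `e 0, e 1, e 2` are `e₁, e₂, e₃`). -/
inductive SymVar
  | e (i : Fin 3)
  | s (i : Fin 3)
  | x
  | y

/-- A variable, as a polynomial. -/
noncomputable abbrev var (v : Var) : MvPolynomial Var k := MvPolynomial.X v

/-- The tangent
`t_i = f'(x_{P_i}) x - 2 y_{P_i} y + (2 y_{P_i}² - f'(x_{P_i}) x_{P_i})`. -/
noncomputable def tangent (D : LinePair k) (i : Fin 3) : MvPolynomial Var k :=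
  aeval (var (.xP i)) (derivative (cubic D.A D.B)) * var .x - 2 * var (.yP i) * var .y
    + (2 * var (.yP i) ^ 2 - aeval (var (.xP i)) (derivative (cubic D.A D.B)) * var (.xP i))

variable (k) in
/-- The chord `r_{ij} = (y_{Q_j} - y_{P_i}) x + (x_{P_i} - x_{Q_j}) y
  + ((x_{Q_j} - x_{P_i}) y_{P_i} + (y_{P_i} - y_{Q_j}) x_{P_i})`. -/
noncomputable def chord (i j : Fin 3) : MvPolynomial Var k :=
  (var (.yQ j) - var (.yP i)) * var .x + (var (.xP i) - var (.xQ j)) * var .y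
    + ((var (.xQ j) - var (.xP i)) * var (.yP i) + (var (.yP i) - var (.yQ j)) * var (.xP i))

/-- `T = t₁ t₂ t₃`. -/
noncomputable def tangentProduct (D : LinePair k) : MvPolynomial Var k := ∏ i, tangent D i

variable (k) in
/-- `R = ∏_{i,j} r_{ij}`. -/
noncomputable def chordProduct : MvPolynomial Var k := ∏ i, ∏ j, chord k i j

/-- Replace `y_{P_i}` by `α₁ x_{P_i} + α₀` and `y_{Q_i}` by `β₁ x_{Q_i} + β₀`. -/
noncomputable def substY (D : LinePair k) : MvPolynomial Var k →ₐ[k] MvPolynomial Var k :=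
  MvPolynomial.bind₁ fun
    | .yP i => MvPolynomial.C D.α₁ * var (.xP i) + MvPolynomial.C D.α₀
    | .yQ i => MvPolynomial.C D.β₁ * var (.xQ i) + MvPolynomial.C D.β₀
    | v => var v

variable (k) in
/-- Expand `e_i` as the `i`-th elementary symmetric polynomial in `x_{P_1}, x_{P_2}, x_{P_3}`, and
`s_i` as the `i`-th elementary symmetric polynomial in `x_{Q_1}, x_{Q_2}, x_{Q_3}`. -/
noncomputable def expand : MvPolynomial SymVar k →ₐ[k] MvPolynomial Var k :=
  MvPolynomial.aeval fun
    | .e i => MvPolynomial.rename Var.xP (MvPolynomial.esymm (Fin 3) k (i + 1))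
    | .s i => MvPolynomial.rename Var.xQ (MvPolynomial.esymm (Fin 3) k (i + 1))
    | .x => var .x
    | .y => var .y

/-- The values `E₁ = α₁²`, `E₂ = A - 2 α₀ α₁`, `E₃ = α₀² - B`. -/
def valueE (D : LinePair k) : Fin 3 → k := ![D.α₁ ^ 2, D.A - 2 * D.α₀ * D.α₁, D.α₀ ^ 2 - D.B]

/-- The values `S₁ = β₁²`, `S₂ = A - 2 β₀ β₁`, `S₃ = β₀² - B`. -/
def valueS (D : LinePair k) : Fin 3 → k := ![D.β₁ ^ 2, D.A - 2 * D.β₀ * D.β₁, D.β₀ ^ 2 - D.B]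

/-- Replace `e_i` by `E_i` and `s_i` by `S_i`, leaving a polynomial in `x, y`. -/
noncomputable def substES (D : LinePair k) : MvPolynomial SymVar k →ₐ[k] k[X][Y] :=
  MvPolynomial.aeval fun
    | .e i => C (C (valueE D i))
    | .s i => C (C (valueS D i))
    | .x => C X
    | .y => Y

/-- `t` is what the polynomial `p` (which will be `T` or `R`) becomes when the `y`-coordinates are
replaced, the result is written as a polynomial in `e_i, s_i, x, y`, and `e_i, s_i` are replaced by
`E_i, S_i`. -/
def IsOutput (D : LinePair k) (p : MvPolynomial Var k) (t : k[X][Y]) : Prop :=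
  ∃ g : MvPolynomial SymVar k, expand k g = substY D p ∧ t = substES D g

/-- `p` and `q` agree modulo `y² - f(x)`, up to multiplication of `q` by a nonzero constant. -/
def EqUpToConst (D : LinePair k) (p q : k[X][Y]) : Prop :=
  ∃ κ : k, κ ≠ 0 ∧ modulus D.A D.B ∣ p - C (C κ) * q

end Procedure

/-- The input with indeterminate line coefficients `α₁, α₀, β₁, β₀`, on a fixed curve. -/
noncomputable def symbolic {F : Type*} [CommRing F] (A B : F) :
    LinePair (MvPolynomial (Fin 4) F) :=
  ⟨.C A, .C B, .X 0, .X 1, .X 2, .X 3⟩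

/-! ## The curve, the Frobenius endomorphism and divisors -/

section Curve

variable {F : Type*} [Field F]

/-- The curve `E : y² = x³ + A x + B`. -/
def curve (A B : F) : WeierstrassCurve.Affine F := ⟨0, 0, 0, A, B⟩

/-- The group `E(K)`. -/
abbrev Pt (K : Type*) [Field K] [Algebra F K] (A B : F) : Type _ :=
  ((curve A B).baseChange K).Point

variable {K : Type*} [Field K] [Algebra F K] {A B : F}

/-- The Frobenius endomorphism `(x, y) ↦ (x ^ q, y ^ q)` of `E(K)`, where `q = #F`. -/
noncomputable def frob [Fintype F] [DecidableEq K] : Pt K A B →+ Pt K A B :=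
  WeierstrassCurve.Affine.Point.map (W' := curve A B) (FiniteField.frobeniusAlgHom F K)

/-- `P` has trace zero: `P + φ(P) + φ²(P) = P_∞`. -/
def TraceZeroPoint [Fintype F] [DecidableEq K] (P : Pt K A B) : Prop :=
  P + frob P + frob (frob P) = 0

/-- The ideal of the coordinate ring `K[E]` of functions vanishing at a point; the unit ideal for
the point at infinity, which does not lie on the affine curve. -/
noncomputable def pointIdeal : Pt K A B → Ideal ((curve A B).baseChange K).CoordinateRing
  | .zero => ⊤
  | .some x y _ => WeierstrassCurve.Affine.CoordinateRing.XYIdeal _ x (C y)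

/-- `div(g) = ∑ᵢ Dᵢ - n P_∞` on `E`, where `n` is the number of points `Dᵢ`: the ideal generated by
`g` in the Dedekind domain `K[E]` is the product of the ideals of the points `Dᵢ`. (This fixes the
multiplicity of every zero of `g` on the affine curve; the multiplicity at `P_∞` is then
the one that makes the degree zero.) -/
def HasDivisor {ι : Type*} [Fintype ι] (g : F[X][Y]) (D : ι → Pt K A B) : Prop :=
  Ideal.span {WeierstrassCurve.Affine.CoordinateRing.mk ((curve A B).baseChange K)
    (g.map (mapRingHom (algebraMap F K)))} = ∏ i, pointIdeal (D i)

variable [Fintype F] [DecidableEq K]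

/-- The points `P, φ(P), φ²(P)`. -/
noncomputable def orbit (P : Pt K A B) (i : Fin 3) : Pt K A B := frob^[i] P

/-- `h_P = y - (m₁ x + m₀)`: this is the line through `P, φ(P), φ²(P)`, counted with multiplicity,
i.e. its divisor is `P + φ(P) + φ²(P) - 3 P_∞`. -/
def IsLineOf (P : Pt K A B) (m₁ m₀ : F) : Prop := HasDivisor (line m₁ m₀) (orbit P)

/-- The points `φⁱ(P) + φʲ(Q)`, `0 ≤ i, j ≤ 2`. -/
noncomputable def sums (P Q : Pt K A B) (ij : Fin 3 × Fin 3) : Pt K A B :=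
  orbit P ij.1 + orbit Q ij.2

end Curve

end TraceZero

open TraceZero

/-! Write $P_i=\varphi^i(P)$ and $Q_j=\varphi^j(Q)$. The tangent at $P_i$ meets the curve in
$P_i,P_i,-2P_i$, and the chord through $P_i\ne Q_j$ meets it in $P_i,Q_j,-(P_i+Q_j)$. On the affine
curve, $T$ therefore has the zeros of $h_P^2$ together with the points $-\varphi^i(2P)$, and $R$ has
those of $h_P^3h_Q^3$ together with the points $-(P_i+Q_j)$. Cancelling the powers of the lines and
applying $y\mapsto-y$ leaves the divisors of $h_{2P}$ and $S_{P,Q}$. Divisors are treated as ideals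
of the coordinate ring $K[E]$, where the units are constants, so a divisor determines a function up
to a constant (`HasDivisor.exists_const`). The geometric input is `span_tangent` and `span_chord`.

The formal rewriting is unique because the elementary symmetric polynomials are algebraically
independent (`expand_injective`). It agrees with substituting actual coordinates because the
$x_{P_i}$ are the roots of $f(x)-(\alpha_1x+\alpha_0)^2$, whose elementary symmetric functions are
the prescribed values (`evalPoints_output`).

The explicit coefficients come from two identities modulo $y^2-f(x)$. `tangentNorm_eq` gives
$T=h_P^2\,(cy+u_0+u_1x)$. `chordNorm_eq` gives $R=-\prod_i h_Q(P_i)\cdot h_P^3h_Q^3\,(S_1-yS_2)$,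
where $S_1$ and $S_2$ are built from the formulas. The constant in the second is nonzero when
$h_P\ne h_Q$. When $h_P=h_Q$ it vanishes, and the formula is checked instead through
$S_{P,P}=h_{-P}^2h_{2P}$ up to a constant (`sumFormula_diagonal`). This uses the trace-zero relation
$P_i+P_j=-P_k$ for distinct indices. -/

namespace TraceZero

/-! ## Norms along a cubic -/

section Norm

variable {S S' : Type*} [CommRing S] [CommRing S']

/-- The product of `a + b z + c z²` over the three roots `z` of `z³ - e₀ z² + e₁ z - e₂`. -/
def quadNorm (e : Fin 3 → S) (a b c : S) : S :=
  a ^ 3 + a ^ 2 * b * e 0 + a ^ 2 * c * (e 0 ^ 2 - 2 * e 1) + a * b ^ 2 * e 1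
    + a * b * c * (e 0 * e 1 - 3 * e 2) + a * c ^ 2 * (e 1 ^ 2 - 2 * e 0 * e 2) + b ^ 3 * e 2
    + b ^ 2 * c * e 0 * e 2 + b * c ^ 2 * e 1 * e 2 + c ^ 3 * e 2 ^ 2

/-- The product of `c₀ + c₁ z + c₂ z² + c₃ z³` over the three roots `z` of
`z³ - e₀ z² + e₁ z - e₂`. -/
def cubicNorm (e : Fin 3 → S) (c₀ c₁ c₂ c₃ : S) : S :=
  quadNorm e (c₀ + c₃ * e 2) (c₁ - c₃ * e 1) (c₂ + c₃ * e 0)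

/-- The product of `(u₀ + u₁ z) w + (v₀ + v₁ z)` over the roots `z` and `w` of the cubics with
elementary symmetric functions `e` and `s`. -/
def bilinearNorm (e s : Fin 3 → S) (u₀ u₁ v₀ v₁ : S) : S :=
  cubicNorm e (u₀ ^ 3 * s 2 + u₀ ^ 2 * v₀ * s 1 + u₀ * v₀ ^ 2 * s 0 + v₀ ^ 3)
    (3 * u₀ ^ 2 * u₁ * s 2 + (2 * u₀ * u₁ * v₀ + u₀ ^ 2 * v₁) * s 1
      + (u₁ * v₀ ^ 2 + 2 * u₀ * v₀ * v₁) * s 0 + 3 * v₀ ^ 2 * v₁)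
    (3 * u₀ * u₁ ^ 2 * s 2 + (u₁ ^ 2 * v₀ + 2 * u₀ * u₁ * v₁) * s 1
      + (2 * u₁ * v₀ * v₁ + u₀ * v₁ ^ 2) * s 0 + 3 * v₀ * v₁ ^ 2)
    (u₁ ^ 3 * s 2 + u₁ ^ 2 * v₁ * s 1 + u₁ * v₁ ^ 2 * s 0 + v₁ ^ 3)

theorem map_quadNorm {G : Type*} [FunLike G S S'] [RingHomClass G S S'] (f : G) (e : Fin 3 → S)
    (a b c : S) : f (quadNorm e a b c) = quadNorm (fun i => f (e i)) (f a) (f b) (f c) := by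
  simp [quadNorm, map_ofNat f]

theorem map_cubicNorm {G : Type*} [FunLike G S S'] [RingHomClass G S S'] (f : G) (e : Fin 3 → S)
    (c₀ c₁ c₂ c₃ : S) :
    f (cubicNorm e c₀ c₁ c₂ c₃) = cubicNorm (fun i => f (e i)) (f c₀) (f c₁) (f c₂) (f c₃) := by
  simp [cubicNorm, map_quadNorm]

theorem map_bilinearNorm {G : Type*} [FunLike G S S'] [RingHomClass G S S'] (f : G)
    (e s : Fin 3 → S) (u₀ u₁ v₀ v₁ : S) :
    f (bilinearNorm e s u₀ u₁ v₀ v₁) =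
      bilinearNorm (fun i => f (e i)) (fun i => f (s i)) (f u₀) (f u₁) (f v₀) (f v₁) := by
  simp [bilinearNorm, map_cubicNorm, map_ofNat f]

/-- The elementary symmetric functions of three elements. -/
def elemSymm (z : Fin 3 → S) : Fin 3 → S :=
  ![z 0 + z 1 + z 2, z 0 * z 1 + z 0 * z 2 + z 1 * z 2, z 0 * z 1 * z 2]

theorem quadNorm_elemSymm (z : Fin 3 → S) (a b c : S) :
    quadNorm (elemSymm z) a b c = ∏ i, (a + b * z i + c * z i ^ 2) := by
  simp only [quadNorm, elemSymm, Fin.prod_univ_three, Matrix.cons_val]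
  ring

theorem cubicNorm_elemSymm (z : Fin 3 → S) (c₀ c₁ c₂ c₃ : S) :
    cubicNorm (elemSymm z) c₀ c₁ c₂ c₃ =
      ∏ i, (c₀ + c₁ * z i + c₂ * z i ^ 2 + c₃ * z i ^ 3) := by
  rw [cubicNorm, quadNorm_elemSymm, Fin.prod_univ_three, Fin.prod_univ_three]
  simp only [elemSymm, Matrix.cons_val]
  congr 1
  · congr 1 <;> ring
  · ring

theorem bilinearNorm_elemSymm (z w : Fin 3 → S) (u₀ u₁ v₀ v₁ : S) :
    bilinearNorm (elemSymm z) (elemSymm w) u₀ u₁ v₀ v₁ =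
      ∏ i, ∏ j, ((u₀ + u₁ * z i) * w j + (v₀ + v₁ * z i)) := by
  rw [bilinearNorm, cubicNorm_elemSymm]
  refine Finset.prod_congr rfl fun i _ => ?_
  simp only [elemSymm, Fin.prod_univ_three, Matrix.cons_val]
  ring

/-- The norm is multiplicative on $S[z]/(z^3-e_0z^2+e_1z-e_2)$. The arguments on the left are the
coefficients of the product of the two quadratics after reducing $z^3$ and $z^4$. -/
theorem quadNorm_mul (e : Fin 3 → S) (a b c l m n : S) :
    quadNorm e (a * l + (b * n + c * m) * e 2 + c * n * (e 0 * e 2))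
      (a * m + b * l - (b * n + c * m) * e 1 + c * n * (e 2 - e 0 * e 1))
      (a * n + b * m + c * l + (b * n + c * m) * e 0 + c * n * (e 0 ^ 2 - e 1)) =
    quadNorm e a b c * quadNorm e l m n := by
  unfold quadNorm
  ring

theorem quadNorm_smul (e : Fin 3 → S) (r a b c : S) :
    quadNorm e (r * a) (r * b) (r * c) = r ^ 3 * quadNorm e a b c := by
  unfold quadNorm
  ring

/-- Substituting $z=x+z'$ replaces the coefficients by the Taylor coefficients at $x$, and the
elementary symmetric functions by those of the shifted roots $z_i-x$. -/
theorem cubicNorm_translate (e : Fin 3 → S) (x c₀ c₁ c₂ c₃ : S) :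
    cubicNorm e c₀ c₁ c₂ c₃ =
      cubicNorm ![e 0 - 3 * x, e 1 - 2 * x * e 0 + 3 * x ^ 2,
        e 2 - x * e 1 + x ^ 2 * e 0 - x ^ 3]
        (c₀ + c₁ * x + c₂ * x ^ 2 + c₃ * x ^ 3) (c₁ + 2 * c₂ * x + 3 * c₃ * x ^ 2)
        (c₂ + 3 * c₃ * x) c₃ := by
  simp only [cubicNorm, quadNorm, Matrix.cons_val]
  ring

end Norm

/-! ## The two polynomial identities behind the formulas -/

section Identities

variable {S : Type*} [CommRing S]

set_option maxHeartbeats 1000000 in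
-- Once $y_{P_i}=\alpha_1z+\alpha_0$ is inserted, each tangent is a cubic in $z=x_{P_i}$ with the
-- four listed coefficients. The left side is thus $T$ at a point of the curve, and the square
-- reflects the tangency at every $P_i$.
theorem tangentNorm_eq (D : LinePair S) (x y : S) (h : y ^ 2 = x ^ 3 + D.A * x + D.B) :
    cubicNorm (valueE D) (D.A * x - 2 * D.α₀ * y + 2 * D.α₀ ^ 2)
      (-2 * D.α₁ * y + 4 * D.α₀ * D.α₁ - D.A) (3 * x + 2 * D.α₁ ^ 2) (-3) =
    (y - (D.α₁ * x + D.α₀)) ^ 2 * (c D * y + (u₀ D + u₁ D * x)) := by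
  obtain ⟨A, B, a, b, β₁, β₀⟩ := D
  -- Solving the curve equation for $B$ turns a congruence modulo $y^2-f(x)$ into a plain polynomial
  -- identity.
  obtain rfl : B = y ^ 2 - x ^ 3 - A * x := by rw [h]; ring
  simp only [valueE, cubicNorm, quadNorm, c, u₀, u₁, Matrix.cons_val]
  ring

set_option maxHeartbeats 1000000 in
-- This replaces `chordNorm_eq` when the two lines coincide, since the constant factor there is then
-- zero. The right side has the divisor predicted by $P_i+P_j=-P_k$ for distinct $i,j,k$.
theorem sumFormula_diagonal (D : LinePair S) (x y : S) (h : y ^ 2 = x ^ 3 + D.A * x + D.B)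
    (h₁ : D.α₁ = D.β₁) (h₀ : D.α₀ = D.β₀) :
    a₄ D * x ^ 4 + a₃ D * x ^ 3 + a₂ D * x ^ 2 + a₁ D * x + a₀ D
      + y * (b₃ D * x ^ 3 + b₂ D * x ^ 2 + b₁ D * x + b₀ D) =
    -((y + (D.α₁ * x + D.α₀)) ^ 2 * (c D * y - (u₀ D + u₁ D * x))) := by
  obtain ⟨A, B, a, b, β₁, β₀⟩ := D
  obtain rfl : a = β₁ := h₁
  obtain rfl : b = β₀ := h₀
  obtain rfl : B = y ^ 2 - x ^ 3 - A * x := by rw [h]; ring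
  simp only [a₄, a₃, a₂, a₁, a₀, b₃, b₂, b₁, b₀, c, u₀, u₁]
  ring

set_option maxHeartbeats 4000000 in
set_option maxRecDepth 10000 in
-- Here $h$ and $k$ are the values of $h_P$ and $h_Q$ at $(x,y)$, $d=f'(x)$, and the first argument
-- lists the symmetric functions of the $x_{P_i}-x$. For fixed $i$, the product of the chords
-- through $P_i$ is $h_Q(P_i)\,h_Q(x,y)$ times a quadratic in $x_{P_i}-x$. As a function of $(x,y)$
-- that last factor keeps the zeros $3P_i$ and $-(P_i+Q_j)$, so its product over $i$ carries
-- $h_P^3$.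
theorem thirdPointNorm_eq (a b x y h k d : S) (D : LinePair S)
    (hD : D = ⟨d - 3 * x ^ 2, y ^ 2 - x ^ 3 - (d - 3 * x ^ 2) * x, a, y - a * x - h, b,
      y - b * x - k⟩) :
    quadNorm ![a ^ 2 - 3 * x, d + 2 * a * h - 2 * y * a, h ^ 2 - 2 * y * h]
      ((k - h) * (2 * y * h) + k * h ^ 2 - 4 * y * k * h)
      ((k - h) * (d - 2 * y * a) + (a - b) * (2 * y * h) - k * (2 * d + 2 * a * h - 4 * y * a))
      ((a - b) * (d - 2 * y * a) - k * (3 * x - a ^ 2)) =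
    -(h ^ 3 * (a₄ D * x ^ 4 + a₃ D * x ^ 3 + a₂ D * x ^ 2 + a₁ D * x + a₀ D
        - y * (b₃ D * x ^ 3 + b₂ D * x ^ 2 + b₁ D * x + b₀ D))) := by
  subst hD
  rw [quadNorm, a₄, a₃, a₂, a₁, a₀, b₃, b₂, b₁, b₀]
  simp only [Matrix.cons_val]
  ring

/-- The factorisation already holds for each $P_i$ separately, in the cubic algebra generated by
$x_{P_i}-x$. The three factors have norms $\prod_i h_Q(P_i)$, $k^3$ and the norm of
`thirdPointNorm_eq`. -/
theorem chordNorm_eq_aux (a b x y h k d : S) :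
    bilinearNorm ![a ^ 2, d - 3 * x ^ 2 - 2 * (y - a * x - h) * a,
        (y - a * x - h) ^ 2 - (y ^ 2 - x ^ 3 - (d - 3 * x ^ 2) * x)]
      ![b ^ 2, d - 3 * x ^ 2 - 2 * (y - b * x - k) * b,
        (y - b * x - k) ^ 2 - (y ^ 2 - x ^ 3 - (d - 3 * x ^ 2) * x)]
      (b * x - y + (y - a * x - h)) (a - b) ((y - b * x - k - (y - a * x - h)) * x)
      (-a * x + y - (y - b * x - k)) =
    quadNorm ![a ^ 2 - 3 * x, d + 2 * a * h - 2 * y * a, h ^ 2 - 2 * y * h] (k - h) (a - b) 0 *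
      (k ^ 3 *
    quadNorm ![a ^ 2 - 3 * x, d + 2 * a * h - 2 * y * a, h ^ 2 - 2 * y * h]
      ((k - h) * (2 * y * h) + k * h ^ 2 - 4 * y * k * h)
      ((k - h) * (d - 2 * y * a) + (a - b) * (2 * y * h) - k * (2 * d + 2 * a * h - 4 * y * a))
      ((a - b) * (d - 2 * y * a) - k * (3 * x - a ^ 2))) := by
  -- Both sides become one norm, so it suffices to compare the shifted symmetric functions and the
  -- three reduced coefficients. The product of nine chords is never expanded.
  rw [bilinearNorm, cubicNorm_translate _ x, ← quadNorm_smul, ← quadNorm_mul, cubicNorm]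
  simp only [Matrix.cons_val]
  congr 1
  · refine congrArg₂ Matrix.vecCons ?_ (congrArg₂ Matrix.vecCons ?_
      (congrArg₂ Matrix.vecCons ?_ rfl)) <;> ring
  · ring
  · ring
  · ring

theorem chordNorm_eq (D : LinePair S) (x y : S) (h : y ^ 2 = x ^ 3 + D.A * x + D.B) :
    bilinearNorm (valueE D) (valueS D) (D.β₁ * x - y + D.α₀) (D.α₁ - D.β₁)
      ((D.β₀ - D.α₀) * x) (-D.α₁ * x + y - D.β₀) =
    -quadNorm (valueE D) (D.α₀ - D.β₀) (D.α₁ - D.β₁) 0 *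
      ((y - (D.α₁ * x + D.α₀)) ^ 3 * (y - (D.β₁ * x + D.β₀)) ^ 3 *
        (a₄ D * x ^ 4 + a₃ D * x ^ 3 + a₂ D * x ^ 2 + a₁ D * x + a₀ D
          - y * (b₃ D * x ^ 3 + b₂ D * x ^ 2 + b₁ D * x + b₀ D))) := by
  obtain ⟨A, B, a, α₀, b, β₀⟩ := D
  -- Pass to the coordinates of `chordNorm_eq_aux`: the values $l,k$ of the two lines at $(x,y)$ and
  -- $d=f'(x)$.
  obtain ⟨l, rfl⟩ : ∃ l, α₀ = y - a * x - l := ⟨y - a * x - α₀, by ring⟩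
  obtain ⟨k, rfl⟩ : ∃ k, β₀ = y - b * x - k := ⟨y - b * x - β₀, by ring⟩
  obtain ⟨d, rfl⟩ : ∃ d, A = d - 3 * x ^ 2 := ⟨A + 3 * x ^ 2, by ring⟩
  obtain rfl : B = y ^ 2 - x ^ 3 - (d - 3 * x ^ 2) * x := by rw [h]; ring
  have e := cubicNorm_translate ![a ^ 2, d - 3 * x ^ 2 - 2 * (y - a * x - l) * a,
    (y - a * x - l) ^ 2 - (y ^ 2 - x ^ 3 - (d - 3 * x ^ 2) * x)] x (k - l - (a - b) * x) (a - b) 0 0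
  simp only [valueE, valueS]
  rw [chordNorm_eq_aux, thirdPointNorm_eq a b x y l k d _ rfl]
  simp only [cubicNorm, zero_mul, mul_zero, add_zero, sub_zero, Matrix.cons_val] at e
  have e₀ : y - a * x - l - (y - b * x - k) = k - l - (a - b) * x := by ring
  have e₁ : d - 3 * x ^ 2 - 2 * (y - a * x - l) * a - 2 * x * a ^ 2 + 3 * x ^ 2 =
    d + 2 * a * l - 2 * y * a := by ring
  have e₂ : (y - a * x - l) ^ 2 - (y ^ 2 - x ^ 3 - (d - 3 * x ^ 2) * x)
      - x * (d - 3 * x ^ 2 - 2 * (y - a * x - l) * a) + x ^ 2 * a ^ 2 - x ^ 3 =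
    l ^ 2 - 2 * y * l := by ring
  rw [e₀, e, e₁, e₂, sub_add_cancel]
  have e₃ : y - (a * x + (y - a * x - l)) = l := by ring
  have e₄ : y - (b * x + (y - b * x - k)) = k := by ring
  rw [e₃, e₄]
  ring

end Identities

/-! ## Rewriting in elementary symmetric polynomials -/

section Expand

open MvPolynomial (rename aeval sumAlgEquiv)

variable {k : Type*} [CommRing k]

/-- Apply `φ` to the variables in the right summand. -/
noncomputable def sumRight (ρ : Type*) {σ τ : Type*} (φ : MvPolynomial σ k →ₐ[k] MvPolynomial τ k) :
    MvPolynomial (ρ ⊕ σ) k →ₐ[k] MvPolynomial (ρ ⊕ τ) k :=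
  aeval (Sum.elim (fun i => .X (.inl i)) fun i => rename Sum.inr (φ (.X i)))

/-- Over the variables in `ρ`, the map only applies `φ` to the coefficients, so injectivity is
inherited coefficientwise. -/
theorem sumRight_injective (ρ : Type*) {σ τ : Type*} {φ : MvPolynomial σ k →ₐ[k] MvPolynomial τ k}
    (hφ : Function.Injective φ) : Function.Injective (sumRight ρ φ) := by
  have h : sumRight ρ φ = ((sumAlgEquiv k ρ τ).symm.toAlgHom.comp (MvPolynomial.mapAlgHom φ)).comp
      (sumAlgEquiv k ρ σ).toAlgHom := by
    ext i : 1
    apply (sumAlgEquiv k ρ τ).injective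
    rcases i with i | i
    · simp [sumRight]
    · have e := DFunLike.congr_fun (MvPolynomial.sumAlgEquiv_comp_rename_inr k ρ τ)
        (φ (.X i))
      simp only [AlgHom.comp_apply, AlgEquiv.toAlgHom_apply] at e
      simp [sumRight, e]
  rw [h]
  simp only [AlgHom.coe_comp]
  exact ((sumAlgEquiv k ρ τ).symm.injective.comp (MvPolynomial.map_injective _ hφ)).comp
    (sumAlgEquiv k ρ σ).injective

/-- Apply `φ` to the variables in the left summand and `ψ` to those in the right summand. -/
noncomputable def sumBoth {σ τ σ' τ' : Type*} (φ : MvPolynomial σ k →ₐ[k] MvPolynomial τ k)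
    (ψ : MvPolynomial σ' k →ₐ[k] MvPolynomial τ' k) :
    MvPolynomial (σ ⊕ σ') k →ₐ[k] MvPolynomial (τ ⊕ τ') k :=
  aeval (Sum.elim (fun i => rename Sum.inl (φ (.X i))) fun i => rename Sum.inr (ψ (.X i)))

theorem sumBoth_injective {σ τ σ' τ' : Type*} {φ : MvPolynomial σ k →ₐ[k] MvPolynomial τ k}
    {ψ : MvPolynomial σ' k →ₐ[k] MvPolynomial τ' k} (hφ : Function.Injective φ)
    (hψ : Function.Injective ψ) : Function.Injective (sumBoth φ ψ) := by
  have h : sumBoth φ ψ = ((rename Sum.swap).comp (sumRight τ' φ)).comp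
      ((rename Sum.swap).comp (sumRight σ ψ)) := by
    ext i : 1
    rcases i with i | i
    · simp only [sumBoth, sumRight, AlgHom.comp_apply, MvPolynomial.aeval_X, Sum.elim_inl,
        MvPolynomial.rename_X, Sum.swap_inl, Sum.elim_inr, MvPolynomial.rename_rename]
      rfl
    · have e : (rename Sum.inr : MvPolynomial τ' k →ₐ[k] MvPolynomial (τ ⊕ τ') k) =
          (rename Sum.swap).comp ((sumRight τ' φ).comp ((rename Sum.swap).comp (rename Sum.inr))) := by
        ext i : 1
        simp [sumRight]
      have e' := DFunLike.congr_fun e (ψ (.X i))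
      simp only [AlgHom.comp_apply] at e'
      simp only [sumBoth, AlgHom.comp_apply, MvPolynomial.aeval_X, Sum.elim_inr, e']
      simp [sumRight]
  rw [h]
  simp only [AlgHom.coe_comp]
  exact ((MvPolynomial.rename_injective _ Sum.swap_leftInverse.injective).comp (sumRight_injective _ hφ)).comp
    ((MvPolynomial.rename_injective _ Sum.swap_leftInverse.injective).comp (sumRight_injective _ hψ))

/-- The fundamental theorem of symmetric polynomials gives injectivity for each group of three
variables. The two groups are disjoint, and $x,y$ are left alone. -/
theorem expand_injective : Function.Injective (expand k) := by
  let s : MvPolynomial (Fin 3) k →ₐ[k] MvPolynomial (Fin 3) k :=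
    (MvPolynomial.symmetricSubalgebra (Fin 3) k).val.comp (MvPolynomial.esymmAlgHom (Fin 3) k 3)
  have hs : Function.Injective s :=
    Subtype.val_injective.comp (MvPolynomial.esymmAlgHom_fin_injective k le_rfl)
  let ι : SymVar → Bool ⊕ (Fin 3 ⊕ Fin 3)
    | .e i => .inr (.inl i)
    | .s i => .inr (.inr i)
    | .x => .inl true
    | .y => .inl false
  let ι' : Bool ⊕ (Fin 3 ⊕ Fin 3) → Var
    | .inr (.inl i) => .xP i
    | .inr (.inr i) => .xQ i
    | .inl true => .x
    | .inl false => .y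
  have hι : Function.Injective ι := by
    rintro (_ | _ | _ | _) (_ | _ | _ | _) <;> simp [ι]
  have hι' : Function.Injective ι' := by
    rintro ((_ | _) | _ | _) ((_ | _) | _ | _) <;> simp [ι']
  have h : expand k = (rename ι').comp ((sumBoth (.id k _) (sumBoth s s)).comp (rename ι)) := by
    ext v : 1
    rcases v with i | i | _ | _
    · simp [expand, sumBoth, ι, ι', s, MvPolynomial.rename_rename]
      rw [MvPolynomial.esymmAlgHom_apply, MvPolynomial.aeval_X]
      rfl
    · simp [expand, sumBoth, ι, ι', s, MvPolynomial.rename_rename]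
      rw [MvPolynomial.esymmAlgHom_apply, MvPolynomial.aeval_X]
      rfl
    · simp [expand, sumBoth, ι, ι']
    · simp [expand, sumBoth, ι, ι']
  rw [h]
  simp only [AlgHom.coe_comp]
  exact (MvPolynomial.rename_injective _ hι').comp
    ((sumBoth_injective Function.injective_id (sumBoth_injective hs hs)).comp
      (MvPolynomial.rename_injective _ hι))

theorem IsOutput.unique {D : LinePair k} {p : MvPolynomial Var k} {t t' : k[X][Y]}
    (h : IsOutput D p t) (h' : IsOutput D p t') : t = t' := by
  obtain ⟨g, hg, rfl⟩ := h
  obtain ⟨g', hg', rfl⟩ := h'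
  rw [expand_injective (hg.trans hg'.symm)]

theorem esymm_fin_three (i : Fin 3) :
    MvPolynomial.esymm (Fin 3) k (i + 1) = elemSymm MvPolynomial.X i := by
  have h₂ : Finset.powersetCard 2 (Finset.univ : Finset (Fin 3)) = {{0, 1}, {0, 2}, {1, 2}} := by
    decide
  have h₃ : Finset.powersetCard 3 (Finset.univ : Finset (Fin 3)) = {{0, 1, 2}} := by decide
  fin_cases i
  · simp [MvPolynomial.esymm_one, elemSymm, Fin.sum_univ_three]
  · simp only [MvPolynomial.esymm, h₂, elemSymm]
    rw [Finset.sum_insert (by decide), Finset.sum_insert (by decide), Finset.sum_singleton]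
    simp [add_assoc]
  · simp [MvPolynomial.esymm, h₃, elemSymm, mul_assoc]

theorem map_elemSymm {S S' : Type*} [CommRing S] [CommRing S'] {G : Type*} [FunLike G S S']
    [RingHomClass G S S'] (f : G) (z : Fin 3 → S) (i : Fin 3) :
    f (elemSymm z i) = elemSymm (fun j => f (z j)) i := by
  fin_cases i <;> simp [elemSymm]

theorem expand_e (i : Fin 3) : expand k (.X (.e i)) = elemSymm (fun j => var (.xP j)) i := by
  simp [expand, esymm_fin_three, map_elemSymm]

theorem expand_s (i : Fin 3) : expand k (.X (.s i)) = elemSymm (fun j => var (.xQ j)) i := by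
  simp [expand, esymm_fin_three, map_elemSymm]

end Expand

/-! ## The output of the procedure -/

section Output

variable {k : Type*} [CommRing k]

/-- The product of the tangents, in terms of the elementary symmetric functions `e`. -/
def tangentNorm {S : Type*} [CommRing S] (A α₁ α₀ : S) (e : Fin 3 → S) (x y : S) : S :=
  cubicNorm e (A * x - 2 * α₀ * y + 2 * α₀ ^ 2) (-2 * α₁ * y + 4 * α₀ * α₁ - A)
    (3 * x + 2 * α₁ ^ 2) (-3)

/-- The product of the chords, in terms of the elementary symmetric functions `e` and `s`. -/
def chordNorm {S : Type*} [CommRing S] (α₁ α₀ β₁ β₀ : S) (e s : Fin 3 → S) (x y : S) : S :=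
  bilinearNorm e s (β₁ * x - y + α₀) (α₁ - β₁) ((β₀ - α₀) * x) (-α₁ * x + y - β₀)

theorem map_tangentNorm {S S' : Type*} [CommRing S] [CommRing S'] {G : Type*} [FunLike G S S']
    [RingHomClass G S S'] (f : G) (A α₁ α₀ : S) (e : Fin 3 → S) (x y : S) :
    f (tangentNorm A α₁ α₀ e x y) =
      tangentNorm (f A) (f α₁) (f α₀) (fun i => f (e i)) (f x) (f y) := by
  simp [tangentNorm, map_cubicNorm, map_ofNat f]

theorem map_chordNorm {S S' : Type*} [CommRing S] [CommRing S'] {G : Type*} [FunLike G S S']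
    [RingHomClass G S S'] (f : G) (α₁ α₀ β₁ β₀ : S) (e s : Fin 3 → S) (x y : S) :
    f (chordNorm α₁ α₀ β₁ β₀ e s x y) =
      chordNorm (f α₁) (f α₀) (f β₁) (f β₀) (fun i => f (e i)) (fun i => f (s i)) (f x) (f y) := by
  simp [chordNorm, map_bilinearNorm]

section SubstY

variable (D : LinePair k)

theorem substY_xP (i : Fin 3) : substY D (var (.xP i)) = var (.xP i) :=
  MvPolynomial.bind₁_X_right _ _

theorem substY_xQ (i : Fin 3) : substY D (var (.xQ i)) = var (.xQ i) :=
  MvPolynomial.bind₁_X_right _ _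

theorem substY_yP (i : Fin 3) : substY D (var (.yP i)) = .C D.α₁ * var (.xP i) + .C D.α₀ :=
  MvPolynomial.bind₁_X_right _ _

theorem substY_yQ (i : Fin 3) : substY D (var (.yQ i)) = .C D.β₁ * var (.xQ i) + .C D.β₀ :=
  MvPolynomial.bind₁_X_right _ _

theorem substY_x : substY D (var .x) = var .x := MvPolynomial.bind₁_X_right _ _

theorem substY_y : substY D (var .y) = var .y := MvPolynomial.bind₁_X_right _ _

theorem expand_x : expand k (.X .x) = var .x := MvPolynomial.aeval_X _ _

theorem expand_y : expand k (.X .y) = var .y := MvPolynomial.aeval_X _ _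

end SubstY

theorem derivative_cubic (A B : k) : derivative (cubic A B) = 3 * X ^ 2 + C A := by
  simp only [cubic, derivative_add, derivative_X_pow, derivative_C_mul, derivative_X, derivative_C]
  simp [map_ofNat C]

/-- The norm is itself a polynomial in the $e_i$, $x$, $y$, hence an explicit rewriting. Expanding
the $e_i$ turns it back into a product over the roots. -/
theorem isOutput_tangentProduct (D : LinePair k) :
    IsOutput D (tangentProduct D) (tangentNorm (C (C D.A)) (C (C D.α₁)) (C (C D.α₀))
      (fun i => C (C (valueE D i))) (C X) Y) := by
  refine ⟨tangentNorm (.C D.A) (.C D.α₁) (.C D.α₀) (fun i => .X (.e i)) (.X .x) (.X .y), ?_, ?_⟩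
  · rw [map_tangentNorm, funext fun i => expand_e (k := k) i, tangentNorm]
    rw [cubicNorm_elemSymm, tangentProduct, map_prod]
    refine Finset.prod_congr rfl fun i _ => ?_
    simp only [tangent, derivative_cubic, map_add, map_sub, map_mul, map_pow, aeval_X, aeval_C,
      map_ofNat, substY_xP, substY_yP, substY_x, substY_y, expand_x, expand_y,
      MvPolynomial.algHom_C, MvPolynomial.algebraMap_eq]
    ring
  · rw [map_tangentNorm]
    simp [substES]

theorem isOutput_chordProduct (D : LinePair k) :
    IsOutput D (chordProduct k) (chordNorm (C (C D.α₁)) (C (C D.α₀)) (C (C D.β₁)) (C (C D.β₀))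
      (fun i => C (C (valueE D i))) (fun i => C (C (valueS D i))) (C X) Y) := by
  refine ⟨chordNorm (.C D.α₁) (.C D.α₀) (.C D.β₁) (.C D.β₀) (fun i => .X (.e i))
    (fun i => .X (.s i)) (.X .x) (.X .y), ?_, ?_⟩
  · rw [map_chordNorm, funext fun i => expand_e (k := k) i, funext fun i => expand_s (k := k) i,
      chordNorm]
    rw [bilinearNorm_elemSymm, chordProduct, map_prod]
    refine Finset.prod_congr rfl fun i _ => ?_
    rw [map_prod]
    refine Finset.prod_congr rfl fun j _ => ?_
    simp only [chord, map_add, map_sub, map_mul, substY_xP, substY_yP, substY_xQ, substY_yQ,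
      substY_x, substY_y, expand_x, expand_y, MvPolynomial.algHom_C, MvPolynomial.algebraMap_eq]
    ring
  · rw [map_chordNorm]
    simp [substES]

theorem existsUnique_isOutput_tangentProduct (D : LinePair k) :
    ∃! t, IsOutput D (tangentProduct D) t :=
  ⟨_, isOutput_tangentProduct D, fun _ h => h.unique (isOutput_tangentProduct D)⟩

theorem existsUnique_isOutput_chordProduct (D : LinePair k) :
    ∃! r, IsOutput D (chordProduct k) r :=
  ⟨_, isOutput_chordProduct D, fun _ h => h.unique (isOutput_chordProduct D)⟩

/-- The substitution `y ↦ -y`. -/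
noncomputable def conjHom : k[X][Y] →+* k[X][Y] := compRingHom (-X)

theorem conjHom_apply (g : k[X][Y]) : conjHom g = conjY g := rfl

@[simp] theorem conjHom_C (p : k[X]) : conjHom (C p) = C p := by simp [conjHom]

@[simp] theorem conjHom_Y : conjHom (Y : k[X][Y]) = -(Y : k[X][Y]) := by simp [conjHom]

@[simp] theorem conjHom_conjHom (g : k[X][Y]) : conjHom (conjHom g) = g := by
  simp [conjHom, comp_assoc]

@[simp] theorem conjHom_modulus (A B : k) : conjHom (modulus A B) = modulus A B := by
  rw [modulus, map_sub, map_pow, conjHom_Y, conjHom_C]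
  ring

theorem modulus_dvd_conjHom {A B : k} {g : k[X][Y]} :
    modulus A B ∣ conjHom g ↔ modulus A B ∣ g := by
  constructor <;> intro h <;> simpa using map_dvd conjHom h

theorem mk_Y_sq (A B : k) :
    AdjoinRoot.mk (modulus A B) Y ^ 2 = AdjoinRoot.mk (modulus A B) (C X) ^ 3
      + AdjoinRoot.mk (modulus A B) (C (C A)) * AdjoinRoot.mk (modulus A B) (C X)
      + AdjoinRoot.mk (modulus A B) (C (C B)) := by
  simp only [← map_pow, ← map_mul, ← map_add]
  rw [AdjoinRoot.mk_eq_mk]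
  simp [modulus, cubic]

/-- The image of the data under a ring homomorphism. -/
def LinePair.map {S : Type*} [CommRing S] (f : k →+* S) (D : LinePair k) : LinePair S :=
  ⟨f D.A, f D.B, f D.α₁, f D.α₀, f D.β₁, f D.β₀⟩

section Map

variable {S : Type*} [CommRing S] (f : k →+* S) (D : LinePair k)

theorem valueE_map : valueE (D.map f) = fun i => f (valueE D i) := by
  funext i
  fin_cases i <;> simp [valueE, LinePair.map, map_ofNat f]

theorem valueS_map : valueS (D.map f) = fun i => f (valueS D i) := by
  funext i
  fin_cases i <;> simp [valueS, LinePair.map, map_ofNat f]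

theorem c_map : c (D.map f) = f (c D) := by simp [c, LinePair.map, map_ofNat f]

theorem u₀_map : u₀ (D.map f) = f (u₀ D) := by simp [u₀, LinePair.map, map_ofNat f]

theorem u₁_map : u₁ (D.map f) = f (u₁ D) := by simp [u₁, LinePair.map, map_ofNat f]

theorem a₄_map : a₄ (D.map f) = f (a₄ D) := by simp [a₄, LinePair.map, map_ofNat f]

theorem a₃_map : a₃ (D.map f) = f (a₃ D) := by simp [a₃, LinePair.map, map_ofNat f]

theorem a₂_map : a₂ (D.map f) = f (a₂ D) := by simp [a₂, LinePair.map, map_ofNat f]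

theorem a₁_map : a₁ (D.map f) = f (a₁ D) := by simp [a₁, LinePair.map, map_ofNat f]

theorem a₀_map : a₀ (D.map f) = f (a₀ D) := by simp [a₀, LinePair.map, map_ofNat f]

theorem b₃_map : b₃ (D.map f) = f (b₃ D) := by simp [b₃, LinePair.map, map_ofNat f]

theorem b₂_map : b₂ (D.map f) = f (b₂ D) := by simp [b₂, LinePair.map, map_ofNat f]

theorem b₁_map : b₁ (D.map f) = f (b₁ D) := by simp [b₁, LinePair.map, map_ofNat f]

theorem b₀_map : b₀ (D.map f) = f (b₀ D) := by simp [b₀, LinePair.map, map_ofNat f]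

end Map

/-- The constants in the ring of functions on the curve. -/
noncomputable def constHom (A B : k) : k →+* AdjoinRoot (modulus A B) :=
  (AdjoinRoot.mk (modulus A B)).comp (C.comp C)

theorem modulus_dvd_tangentProduct_output {D : LinePair k} {t : k[X][Y]}
    (h : IsOutput D (tangentProduct D) t) :
    modulus D.A D.B ∣ conjY t - C (C (-1)) * (line (-D.α₁) (-D.α₀) ^ 2 * doublingFormula D) := by
  rw [h.unique (isOutput_tangentProduct D), ← conjHom_apply, ← AdjoinRoot.mk_eq_mk, map_tangentNorm,
    map_tangentNorm]
  -- The identity is applied at the generic point with $y$ replaced by $-y$. This turns $h_P^2$ into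
  -- $h_{-P}^2$ and produces the constant $-1$.
  have key := tangentNorm_eq (D.map (constHom D.A D.B))
    (AdjoinRoot.mk _ (C X)) (-AdjoinRoot.mk _ Y) (by rw [neg_sq]; exact mk_Y_sq D.A D.B)
  rw [valueE_map, c_map, u₀_map, u₁_map] at key
  simp only [conjHom_C, conjHom_Y, map_neg]
  refine key.trans ?_
  simp only [LinePair.map, constHom, RingHom.comp_apply, doublingFormula, line, map_mul, map_add,
    map_sub, map_pow, map_neg, map_one]
  ring

theorem modulus_dvd_chordProduct_output {D : LinePair k} {r : k[X][Y]}
    (h : IsOutput D (chordProduct k) r) :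
    modulus D.A D.B ∣ r - C (C (-quadNorm (valueE D) (D.α₀ - D.β₀) (D.α₁ - D.β₁) 0)) *
      (line D.α₁ D.α₀ ^ 3 * line D.β₁ D.β₀ ^ 3 * conjY (sumFormula D)) := by
  rw [h.unique (isOutput_chordProduct D), ← conjHom_apply, ← AdjoinRoot.mk_eq_mk, map_chordNorm]
  have key := chordNorm_eq (D.map (constHom D.A D.B))
    (AdjoinRoot.mk _ (C X)) (AdjoinRoot.mk _ Y) (mk_Y_sq D.A D.B)
  rw [valueE_map, valueS_map, a₀_map, a₁_map, a₂_map, a₃_map, a₄_map, b₀_map, b₁_map, b₂_map,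
    b₃_map] at key
  refine key.trans ?_
  simp only [sumFormula, sumPart₁, sumPart₂, line, map_mul, map_add, map_sub, map_pow, map_neg,
    conjHom_C, conjHom_Y, map_quadNorm, map_zero]
  simp only [LinePair.map, constHom, RingHom.comp_apply]
  ring

theorem modulus_dvd_sumFormula_of_eq {D : LinePair k} (h₁ : D.α₁ = D.β₁) (h₀ : D.α₀ = D.β₀) :
    modulus D.A D.B ∣
      sumFormula D - C (C (-1)) * (line (-D.α₁) (-D.α₀) ^ 2 * doublingFormula D) := by
  rw [← AdjoinRoot.mk_eq_mk]
  have key := sumFormula_diagonal (D.map (constHom D.A D.B)) (AdjoinRoot.mk _ (C X))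
    (AdjoinRoot.mk _ Y) (mk_Y_sq D.A D.B) (by simp [LinePair.map, h₁]) (by simp [LinePair.map, h₀])
  rw [a₀_map, a₁_map, a₂_map, a₃_map, a₄_map, b₀_map, b₁_map, b₂_map, b₃_map, c_map, u₀_map,
    u₁_map] at key
  simp only [LinePair.map, constHom, RingHom.comp_apply] at key
  simp only [sumFormula, sumPart₁, sumPart₂, doublingFormula, line, map_mul, map_add, map_sub,
    map_pow, map_neg, map_one]
  linear_combination key

end Output

/-! ## Functions and ideals on the curve -/

section Functions

open WeierstrassCurve.Affine WeierstrassCurve.Affine.CoordinateRing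

variable {F : Type*} [Field F] {K : Type*} [Field K] [Algebra F K] {A B : F}

theorem polynomial_curve (A B : F) : (curve A B).polynomial = modulus A B := by
  simp [curve, WeierstrassCurve.Affine.polynomial, modulus, cubic]

variable (K A B) in
/-- The function on the curve over `K` given by a polynomial over `F`. -/
noncomputable def functionOf : F[X][Y] →+* ((curve A B).baseChange K).CoordinateRing :=
  (CoordinateRing.mk ((curve A B).baseChange K)).comp (mapRingHom (mapRingHom (algebraMap F K)))

theorem functionOf_apply (g : F[X][Y]) : functionOf K A B g =
    CoordinateRing.mk ((curve A B).baseChange K) (g.map (mapRingHom (algebraMap F K))) := rfl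

/-- Base change of coordinate rings is injective, so vanishing over $K$ is already divisibility over
$F$. -/
theorem functionOf_eq_zero {g : F[X][Y]} : functionOf K A B g = 0 ↔ modulus A B ∣ g := by
  rw [← polynomial_curve, ← AdjoinRoot.mk_eq_zero]
  rw [← map_eq_zero_iff _ (CoordinateRing.map_injective (W' := curve A B)
    (algebraMap F K).injective)]
  erw [CoordinateRing.map_mk]
  rfl

theorem functionOf_eq {g h : F[X][Y]} :
    functionOf K A B g = functionOf K A B h ↔ modulus A B ∣ g - h := by
  rw [← functionOf_eq_zero (K := K), map_sub, sub_eq_zero]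

theorem hasDivisor_iff {ι : Type*} [Fintype ι] {g : F[X][Y]} {D : ι → Pt K A B} :
    HasDivisor g D ↔ Ideal.span {functionOf K A B g} = ∏ i, pointIdeal (D i) := Iff.rfl

section Conjugation

theorem polynomial_baseChange (A B : F) : ((curve A B).baseChange K).polynomial =
    modulus (algebraMap F K A) (algebraMap F K B) := by
  simp [curve, WeierstrassCurve.baseChange, WeierstrassCurve.Affine.polynomial, modulus, cubic]

theorem eval₂_conj (W : WeierstrassCurve.Affine K) (g : K[X][Y]) :
    eval₂ ((CoordinateRing.mk W).comp C) (-CoordinateRing.mk W Y) g =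
      CoordinateRing.mk W (conjY g) := by
  rw [conjY, Polynomial.comp, hom_eval₂, map_neg]

/-- The automorphism `y ↦ -y` of the coordinate ring. -/
noncomputable def conjRing : ((curve A B).baseChange K).CoordinateRing →+*
    ((curve A B).baseChange K).CoordinateRing :=
  AdjoinRoot.lift ((CoordinateRing.mk ((curve A B).baseChange K)).comp C)
    (-CoordinateRing.mk ((curve A B).baseChange K) Y) (by
      have h : conjY ((curve A B).baseChange K).polynomial =
          ((curve A B).baseChange K).polynomial := by
        rw [polynomial_baseChange, ← conjHom_apply, conjHom_modulus]
      rw [eval₂_conj, h]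
      exact AdjoinRoot.mk_self)

theorem conjRing_mk (g : K[X][Y]) : conjRing (CoordinateRing.mk ((curve A B).baseChange K) g) =
    CoordinateRing.mk ((curve A B).baseChange K) (conjY g) :=
  (AdjoinRoot.lift_mk _ _).trans (eval₂_conj _ g)

theorem negY_baseChange (x y : K) : ((curve A B).baseChange K).negY x y = -y := by
  simp [WeierstrassCurve.Affine.negY, curve, WeierstrassCurve.baseChange]

theorem conjRing_functionOf (g : F[X][Y]) :
    conjRing (functionOf K A B g) = functionOf K A B (conjY g) := by
  rw [functionOf_apply, conjRing_mk, functionOf_apply, conjY, conjY, map_comp]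
  simp

theorem map_conjRing_pointIdeal [DecidableEq K] (P : Pt K A B) :
    (pointIdeal P).map conjRing = pointIdeal (-P) := by
  rcases P with _ | ⟨x, y, h⟩
  · exact Ideal.map_top _
  · rw [Point.neg_some]
    simp only [pointIdeal, XYIdeal, Ideal.map_span, Set.image_pair, XClass, YClass, conjRing_mk]
    have e₁ : conjY (C (X - C x)) = C (X - C x) := by rw [← conjHom_apply, conjHom_C]
    have e₂ : conjY (Y - C (C y)) = -(Y - C (C (-y))) := by
      rw [← conjHom_apply, map_sub, conjHom_C, conjHom_Y, C_neg, C_neg]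
      ring
    rw [e₁, e₂, negY_baseChange, map_neg, Ideal.span_insert, Ideal.span_singleton_neg,
      ← Ideal.span_insert]

end Conjugation

theorem mk_C_dvd_mk_C {W : WeierstrassCurve.Affine K} {p q : K[X]}
    (h : CoordinateRing.mk W (C p) ∣ CoordinateRing.mk W (C q)) : p ∣ q := by
  obtain ⟨z, hz⟩ := h
  obtain ⟨r, s, rfl⟩ := exists_smul_basis_eq z
  rw [mul_comm, smul_basis_mul_C] at hz
  have : (q - r * p) • (1 : W.CoordinateRing) + (-(s * p)) • CoordinateRing.mk W Y = 0 := by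
    simp only [CoordinateRing.smul, map_sub, map_mul, map_neg, mul_one] at hz ⊢
    rw [hz]
    ring
  exact ⟨r, by linear_combination (smul_basis_eq_zero this).1⟩

/-- The norm of $p+qY$ to $K[X]$ has degree $\max(2\deg p,\,2\deg q+3)$. For a unit this is $0$,
which forces $q=0$ and $p$ constant. -/
theorem isUnit_iff_const {W : WeierstrassCurve.Affine K} {u : W.CoordinateRing} (hu : IsUnit u) :
    ∃ κ : K, κ ≠ 0 ∧ u = CoordinateRing.mk W (C (C κ)) := by
  obtain ⟨p, q, rfl⟩ := exists_smul_basis_eq u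
  have h : (Algebra.norm K[X] (p • (1 : W.CoordinateRing) + q • CoordinateRing.mk W Y)).degree = 0 :=
    degree_eq_zero_of_isUnit (hu.map _)
  rw [degree_norm_smul_basis] at h
  have hq : q = 0 := by
    by_contra hq
    rw [degree_eq_natDegree hq] at h
    have := h ▸ le_max_right (2 • p.degree) (2 • (q.natDegree : WithBot ℕ) + 3)
    norm_cast at this
  subst hq
  have hp : p.degree = 0 := by
    rw [degree_zero] at h
    rcases eq_or_ne p 0 with rfl | hp
    · simp at h
    · rw [degree_eq_natDegree hp, two_nsmul ⊥, WithBot.bot_add, WithBot.bot_add, max_bot_right] at h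
      rw [degree_eq_natDegree hp]
      norm_cast at h ⊢
      simpa using h
  have hp' := eq_C_of_degree_eq_zero hp
  refine ⟨p.coeff 0, fun h0 => ?_, ?_⟩
  · rw [hp', h0] at hp
    simp at hp
  · rw [zero_smul, add_zero, CoordinateRing.smul, mul_one, ← hp']

theorem evalEval_of_mem {W : WeierstrassCurve.Affine K} {x y : K} (h : W.Equation x y) {g : K[X][Y]}
    (hg : CoordinateRing.mk W g ∈ XYIdeal W x (C y)) : g.evalEval x y = 0 := by
  let e : W.CoordinateRing →+* K := AdjoinRoot.lift (evalRingHom x) y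
    (by rw [eval₂_evalRingHom]; exact h)
  have he (p : K[X][Y]) : e (CoordinateRing.mk W p) = p.evalEval x y := by
    rw [← eval₂_evalRingHom]
    exact AdjoinRoot.lift_mk _ _
  have hle : XYIdeal W x (C y) ≤ RingHom.ker e := by
    rw [XYIdeal, Ideal.span_le]
    rintro z (rfl | rfl)
    · rw [SetLike.mem_coe, RingHom.mem_ker, XClass, he, evalEval_C]
      simp
    · rw [SetLike.mem_coe, RingHom.mem_ker, YClass, he, evalEval_sub, evalEval_C]
      simp
  rw [← he]
  exact hle hg

end Functions

/-! ## Lines and divisors -/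

section Lines

open WeierstrassCurve.Affine WeierstrassCurve.Affine.CoordinateRing

variable {F : Type*} [Field F] {K : Type*} [Field K] [Algebra F K] {A B : F}

theorem equation_baseChange {x y : K} :
    ((curve A B).baseChange K).Equation x y ↔
      y ^ 2 = x ^ 3 + algebraMap F K A * x + algebraMap F K B := by
  rw [WeierstrassCurve.Affine.equation_iff]
  simp [curve, WeierstrassCurve.baseChange]

theorem pointIdeal_mul_neg {x y : K} (h : ((curve A B).baseChange K).Nonsingular x y) :
    pointIdeal (Point.some x y h : Pt K A B) * pointIdeal (-Point.some x y h : Pt K A B) =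
      Ideal.span {CoordinateRing.mk _ (C (X - C x))} := by
  rw [mul_comm, Point.neg_some]
  exact XYIdeal_neg_mul h

theorem pointIdeal_zero : pointIdeal (0 : Pt K A B) = 1 := Ideal.one_eq_top.symm

theorem span_const_mul {W : WeierstrassCurve.Affine K} {κ : K} (hκ : κ ≠ 0) (g : K[X][Y]) :
    Ideal.span {CoordinateRing.mk W (C (C κ) * g)} = Ideal.span {CoordinateRing.mk W g} := by
  rw [map_mul]
  refine Ideal.span_singleton_mul_left_unit ?_ _
  exact ((isUnit_iff_ne_zero.mpr hκ).map (C.comp C : K →+* K[X][Y])).map _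

variable [DecidableEq K]

theorem span_linePolynomial {x₁ y₁ x₂ y₂ : K} (h₁ : ((curve A B).baseChange K).Nonsingular x₁ y₁)
    (h₂ : ((curve A B).baseChange K).Nonsingular x₂ y₂)
    (hxy : ¬(x₁ = x₂ ∧ y₁ = ((curve A B).baseChange K).negY x₂ y₂)) :
    Ideal.span {CoordinateRing.mk ((curve A B).baseChange K) (Y - C (linePolynomial x₁ y₁
      (((curve A B).baseChange K).slope x₁ x₂ y₁ y₂)))} =
    pointIdeal (Point.some x₁ y₁ h₁ : Pt K A B) * pointIdeal (Point.some x₂ y₂ h₂ : Pt K A B) *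
      pointIdeal (-(Point.some x₁ y₁ h₁ + Point.some x₂ y₂ h₂) : Pt K A B) := by
  have key := XYIdeal_mul_XYIdeal h₁.left h₂.left hxy
  have hs := Point.add_some hxy (h₁ := h₁) (h₂ := h₂)
  have hn := pointIdeal_mul_neg (nonsingular_add h₁ h₂ hxy)
  rw [← hs] at hn
  -- Multiplying by $X-x(P+Q)$ brings in the product formula for point ideals. The extra factor is
  -- then absorbed as the product of the ideals of $P+Q$ and $-(P+Q)$.
  rw [← Ideal.span_singleton_mul_right_inj (XClass_ne_zero _)]
  change _ * YIdeal _ _ = XIdeal _ (((curve A B).baseChange K).addX x₁ x₂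
    (((curve A B).baseChange K).slope x₁ x₂ y₁ y₂)) * _
  rw [← mul_assoc]
  have hp : pointIdeal (Point.some x₁ y₁ h₁ + Point.some x₂ y₂ h₂ : Pt K A B) =
      XYIdeal _ (((curve A B).baseChange K).addX x₁ x₂
        (((curve A B).baseChange K).slope x₁ x₂ y₁ y₂))
        (C (((curve A B).baseChange K).addY x₁ x₂ y₁
          (((curve A B).baseChange K).slope x₁ x₂ y₁ y₂))) := by rw [hs]; rfl
  erw [key]
  rw [← hp]
  rw [mul_assoc, hn, mul_comm]
  rfl

theorem span_chord {x₁ y₁ x₂ y₂ : K} (h₁ : ((curve A B).baseChange K).Nonsingular x₁ y₁)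
    (h₂ : ((curve A B).baseChange K).Nonsingular x₂ y₂)
    (hne : (Point.some x₁ y₁ h₁ : Pt K A B) ≠ Point.some x₂ y₂ h₂) :
    Ideal.span {CoordinateRing.mk ((curve A B).baseChange K)
      (C (C (y₂ - y₁)) * C X + C (C (x₁ - x₂)) * Y
        + C (C ((x₂ - x₁) * y₁ + (y₁ - y₂) * x₁)))} =
    pointIdeal (Point.some x₁ y₁ h₁ : Pt K A B) * pointIdeal (Point.some x₂ y₂ h₂ : Pt K A B) *
      pointIdeal (-(Point.some x₁ y₁ h₁ + Point.some x₂ y₂ h₂) : Pt K A B) := by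
  by_cases hx : x₁ = x₂
  · subst hx
    -- Distinct points with equal abscissa are opposite: the chord is vertical and its third point
    -- is at infinity, contributing the unit ideal.
    have hy : y₁ ≠ y₂ := fun hy => hne (by subst hy; rfl)
    have hy' := (Y_eq_of_X_eq h₁.left h₂.left rfl).resolve_left hy
    rw [Point.add_of_Y_eq rfl hy', neg_zero, pointIdeal_zero, mul_one]
    have e : C (C (y₂ - y₁)) * C X + C (C (x₁ - x₁)) * Y
        + C (C ((x₁ - x₁) * y₁ + (y₁ - y₂) * x₁)) = C (C (y₂ - y₁)) * C (X - C x₁) := by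
      rw [show (x₁ - x₁) * y₁ + (y₁ - y₂) * x₁ = -((y₂ - y₁) * x₁) by ring, sub_self]
      simp only [C_sub, C_mul, C_neg, C_0]
      ring
    rw [e, span_const_mul (sub_ne_zero.mpr hy.symm), ← pointIdeal_mul_neg h₁]
    have hQ : (-Point.some x₁ y₁ h₁ : Pt K A B) = Point.some x₁ y₂ h₂ := by
      rw [neg_eq_iff_add_eq_zero, Point.add_of_Y_eq rfl hy']
    rw [hQ]
  · rw [← span_linePolynomial h₁ h₂ (fun h => hx h.1), ← span_const_mul (sub_ne_zero.mpr hx) (Y - C _),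
      slope_of_X_ne hx]
    have e : y₁ - y₂ = (x₁ - x₂) * ((y₁ - y₂) / (x₁ - x₂)) := by
      rw [mul_div_cancel₀ _ (sub_ne_zero.mpr hx)]
    congr 3
    generalize (y₁ - y₂) / (x₁ - x₂) = l at *
    obtain rfl : y₂ = y₁ - (x₁ - x₂) * l := by linear_combination -e
    simp only [linePolynomial, C_sub, C_mul, C_add]
    ring

theorem span_tangent (h2 : (2 : K) ≠ 0) {x y : K}
    (h : ((curve A B).baseChange K).Nonsingular x y) :
    Ideal.span {CoordinateRing.mk ((curve A B).baseChange K)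
      (C (C (3 * x ^ 2 + algebraMap F K A)) * C X - C (C (2 * y)) * Y
        + C (C (2 * y ^ 2 - (3 * x ^ 2 + algebraMap F K A) * x)))} =
    pointIdeal (Point.some x y h : Pt K A B) * pointIdeal (Point.some x y h : Pt K A B) *
      pointIdeal (-(2 • Point.some x y h) : Pt K A B) := by
  rw [two_nsmul]
  by_cases hy : y = 0
  · subst hy
    -- At a point of order two the tangent is vertical, and nonsingularity with $y=0$ supplies
    -- $f'(x)\ne0$.
    have hs : (3 * x ^ 2 + algebraMap F K A) ≠ 0 := by
      have := ((WeierstrassCurve.Affine.nonsingular_iff' _ _).mp h).2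
      simp [curve, WeierstrassCurve.baseChange] at this
      contrapose! this
      linear_combination -this
    have hn : (-Point.some x 0 h : Pt K A B) = Point.some x 0 h := by
      rw [Point.neg_some]
      exact (Point.some.injEq ..).mpr ⟨rfl, by rw [negY_baseChange, neg_zero]⟩
    have h0 : (Point.some x 0 h + Point.some x 0 h : Pt K A B) = 0 := by
      nth_rw 1 [← hn]
      exact neg_add_cancel _
    rw [h0, neg_zero, pointIdeal_zero, mul_one]
    nth_rw 2 [← hn]
    rw [pointIdeal_mul_neg, ← span_const_mul hs (C (X - C x))]
    congr 3
    simp only [mul_zero, C_sub, C_mul, C_0, ne_eq, OfNat.ofNat_ne_zero, not_false_eq_true,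
      zero_pow]
    ring
  · have hy' : ¬(x = x ∧ y = ((curve A B).baseChange K).negY x y) := by
      rw [negY_baseChange]
      rintro ⟨-, h'⟩
      exact mul_ne_zero h2 hy (by linear_combination h')
    have h2y : -(2 * y) ≠ 0 := neg_ne_zero.mpr (mul_ne_zero h2 hy)
    rw [← span_linePolynomial h h hy', ← span_const_mul h2y (Y - C _), slope_of_Y_ne rfl fun h => hy' ⟨rfl, h⟩]
    rw [negY_baseChange]
    simp only [curve, WeierstrassCurve.baseChange, WeierstrassCurve.map_a₁,
      WeierstrassCurve.map_a₂, WeierstrassCurve.map_a₄, map_zero]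
    have e : 3 * x ^ 2 + algebraMap F K A = 2 * y *
        ((3 * x ^ 2 + 2 * 0 * x + algebraMap F K A - 0 * y) / (y - -y)) := by
      rw [show y - -y = 2 * y by ring, mul_div_cancel₀ _ (mul_ne_zero h2 hy)]
      ring
    congr 3
    rw [e]
    generalize (3 * x ^ 2 + 2 * 0 * x + algebraMap F K A - 0 * y) / (y - -y) = l
    simp only [linePolynomial, C_sub, C_mul, C_add, C_neg, C_pow]
    ring

end Lines

/-! ## Functions with a given divisor -/

section Divisors

open WeierstrassCurve.Affine WeierstrassCurve.Affine.CoordinateRing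

variable {F : Type*} [Field F] {K : Type*} [Field K] [Algebra F K] {A B : F}
  {ι : Type*} [Fintype ι]

theorem exists_normal_form (A B : F) (g : F[X][Y]) :
    ∃ p q : F[X], modulus A B ∣ g - (C p + Y * C q) := by
  obtain ⟨p, q, h⟩ := exists_smul_basis_eq (CoordinateRing.mk (curve A B) g)
  refine ⟨p, q, ?_⟩
  rw [← polynomial_curve, ← AdjoinRoot.mk_eq_mk]
  refine h.symm.trans ?_
  rw [CoordinateRing.smul, CoordinateRing.smul, mul_one, mul_comm, ← map_mul, ← map_add]

theorem normal_form_eq {W : WeierstrassCurve.Affine K} {p q p' q' : K[X]}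
    (h : CoordinateRing.mk W (C p + Y * C q) = CoordinateRing.mk W (C p' + Y * C q')) :
    p = p' ∧ q = q' := by
  have : (p - p') • (1 : W.CoordinateRing) + (q - q') • CoordinateRing.mk W Y = 0 := by
    simp only [CoordinateRing.smul, map_sub, map_add, map_mul, mul_one] at h ⊢
    linear_combination h
  obtain ⟨h₁, h₂⟩ := smul_basis_eq_zero this
  exact ⟨sub_eq_zero.mp h₁, sub_eq_zero.mp h₂⟩

theorem functionOf_normal_form (p q : F[X]) : functionOf K A B (C p + Y * C q) =
    CoordinateRing.mk _ (C (p.map (algebraMap F K)) + Y * C (q.map (algebraMap F K))) := by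
  simp [functionOf_apply]

theorem span_functionOf_eq {g g₀ : F[X][Y]} {κ : F} (hκ : κ ≠ 0)
    (h : modulus A B ∣ g - C (C κ) * g₀) :
    Ideal.span {functionOf K A B g} = Ideal.span {functionOf K A B g₀} := by
  rw [functionOf_eq.mpr h, map_mul]
  exact Ideal.span_singleton_mul_left_unit
    (((isUnit_iff_ne_zero.mpr hκ).map (C.comp C : F →+* F[X][Y])).map (functionOf K A B)) _

theorem HasDivisor.of_modulus_dvd {g g₀ : F[X][Y]} {D : ι → Pt K A B} (h₀ : HasDivisor g₀ D) {κ : F}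
    (hκ : κ ≠ 0) (h : modulus A B ∣ g - C (C κ) * g₀) : HasDivisor g D := by
  rw [hasDivisor_iff, span_functionOf_eq hκ h]
  exact h₀

/-- Generators of the same ideal differ by a unit, that is, by a constant of $K$. In the basis $1,Y$
this constant is a ratio of coefficients from $F$, so it lies in $F$. -/
theorem HasDivisor.exists_const {g g₀ : F[X][Y]} {D : ι → Pt K A B} (h : HasDivisor g D)
    (h₀ : HasDivisor g₀ D) : ∃ κ : F, κ ≠ 0 ∧ modulus A B ∣ g - C (C κ) * g₀ := by
  rw [hasDivisor_iff] at h h₀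
  obtain ⟨u, hu⟩ := Ideal.span_singleton_eq_span_singleton.mp (h₀.trans h.symm)
  obtain ⟨κ, hκ, hu'⟩ := isUnit_iff_const u.isUnit
  obtain ⟨p, q, hpq⟩ := exists_normal_form A B g
  obtain ⟨p₀, q₀, hpq₀⟩ := exists_normal_form A B g₀
  rw [← functionOf_eq (K := K)] at hpq hpq₀
  rw [hpq, hpq₀, hu', functionOf_normal_form, functionOf_normal_form, ← map_mul,
    show (C (p₀.map (algebraMap F K)) + Y * C (q₀.map (algebraMap F K))) * C (C κ) =
      C (p₀.map (algebraMap F K) * C κ) + Y * C (q₀.map (algebraMap F K) * C κ) by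
        rw [C_mul, C_mul]; ring] at hu
  obtain ⟨hp, hq⟩ := normal_form_eq hu
  have key : ∃ l : F, l ≠ 0 ∧ p = p₀ * C l ∧ q = q₀ * C l := by
    have aux {r r₀ : F[X]} (hr : r₀.map (algebraMap F K) * C κ = r.map (algebraMap F K)) {n : ℕ}
        (hn : r₀.coeff n ≠ 0) : algebraMap F K (r.coeff n / r₀.coeff n) = κ := by
      have := congrArg (coeff · n) hr
      simp only [coeff_mul_C, coeff_map] at this
      rw [map_div₀, ← this, mul_div_cancel_left₀ _ ((_root_.map_ne_zero _).mpr hn)]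
    have aux' : (∃ l : F, algebraMap F K l = κ) ∨ (p₀ = 0 ∧ q₀ = 0) := by
      by_cases hp₀ : p₀ = 0
      · by_cases hq₀ : q₀ = 0
        · exact .inr ⟨hp₀, hq₀⟩
        · exact .inl ⟨_, aux hq (leadingCoeff_ne_zero.mpr hq₀)⟩
      · exact .inl ⟨_, aux hp (leadingCoeff_ne_zero.mpr hp₀)⟩
    rcases aux' with ⟨l, rfl⟩ | ⟨rfl, rfl⟩
    · refine ⟨l, by simpa using hκ, ?_, ?_⟩ <;>
        refine map_injective _ (algebraMap F K).injective ?_ <;> simp [hp, hq]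
    -- If $g_0$ vanishes on the curve, so does $g$, and the constant $1$ serves.
    · simp only [Polynomial.map_zero, zero_mul] at hp hq
      refine ⟨1, one_ne_zero, ?_, ?_⟩ <;>
        refine map_injective _ (algebraMap F K).injective ?_ <;> simp [← hp, ← hq]
  obtain ⟨l, hl, rfl, rfl⟩ := key
  refine ⟨l, hl, ?_⟩
  rw [← functionOf_eq (K := K), map_mul, hpq, hpq₀, ← map_mul]
  congr 1
  rw [C_mul, C_mul]
  ring

theorem HasDivisor.iff_exists_const {g₀ : F[X][Y]} {D : ι → Pt K A B} (h₀ : HasDivisor g₀ D)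
    (g : F[X][Y]) : HasDivisor g D ↔ ∃ κ : F, κ ≠ 0 ∧ modulus A B ∣ g - C (C κ) * g₀ :=
  ⟨fun h => h.exists_const h₀, fun ⟨_, hκ, h⟩ => h₀.of_modulus_dvd hκ h⟩

theorem modulus_dvd_normal_form {p q p' q' : F[X]} :
    modulus A B ∣ C p + Y * C q - (C p' + Y * C q') ↔ p = p' ∧ q = q' := by
  refine ⟨fun h => ?_, fun ⟨h, h'⟩ => by simp [h, h']⟩
  rw [← polynomial_curve, ← AdjoinRoot.mk_eq_mk] at h
  exact normal_form_eq h

theorem HasDivisor.conjY [DecidableEq K] {g : F[X][Y]} {D : ι → Pt K A B} (h : HasDivisor g D) :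
    HasDivisor (conjY g) fun i => -D i := by
  rw [hasDivisor_iff] at h ⊢
  rw [← conjRing_functionOf, ← Set.image_singleton, ← Ideal.map_span, h]
  refine (map_prod (Ideal.mapHom conjRing) _ _).trans ?_
  exact Finset.prod_congr rfl fun i _ => map_conjRing_pointIdeal (D i)

/-- A function whose divisor is supported at finite points has norm `∏ᵢ (x - xᵢ)`. -/
theorem HasDivisor.span_mul_conjY [DecidableEq K] {g : F[X][Y]} {x y : ι → K}
    {hxy : ∀ i, ((curve A B).baseChange K).Nonsingular (x i) (y i)}
    (h : HasDivisor g fun i => (Point.some (x i) (y i) (hxy i) : Pt K A B)) :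
    Ideal.span {functionOf K A B (g * TraceZero.conjY g)} =
      Ideal.span {CoordinateRing.mk ((curve A B).baseChange K) (C (∏ i, (X - C (x i))))} := by
  have h' := h.conjY
  rw [hasDivisor_iff] at h h'
  rw [map_mul, ← Ideal.span_singleton_mul_span_singleton, h, h', ← Finset.prod_mul_distrib,
    Finset.prod_congr rfl fun i _ => pointIdeal_mul_neg (hxy i), Ideal.prod_span_singleton,
    map_prod, map_prod]

theorem prod_eq_of_span_eq {W : WeierstrassCurve.Affine K} {p q : K[X]} (hp : p.Monic) (hq : q.Monic)
    (h : Ideal.span {CoordinateRing.mk W (C p)} = Ideal.span {CoordinateRing.mk W (C q)}) :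
    p = q := by
  obtain ⟨h₁, h₂⟩ := dvd_dvd_iff_associated.mpr (Ideal.span_singleton_eq_span_singleton.mp h)
  exact eq_of_monic_of_associated hp hq
    (associated_of_dvd_dvd (mk_C_dvd_mk_C h₁) (mk_C_dvd_mk_C h₂))

/-- The `x`-coordinates of the intersection of a line with the curve. -/
theorem prod_of_hasDivisor_line [DecidableEq K] {m₁ m₀ : F} {x y : Fin 3 → K}
    {hxy : ∀ i, ((curve A B).baseChange K).Nonsingular (x i) (y i)}
    (h : HasDivisor (line m₁ m₀) fun i => (Point.some (x i) (y i) (hxy i) : Pt K A B)) :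
    ∏ i, (X - C (x i)) =
      (cubic A B - (C m₁ * X + C m₀) ^ 2).map (algebraMap F K) := by
  have hm : (cubic A B - (C m₁ * X + C m₀) ^ 2).Monic := by
    have : cubic A B - (C m₁ * X + C m₀) ^ 2 =
        C 1 * X ^ 3 + C (-m₁ ^ 2) * X ^ 2 + C (A - 2 * m₁ * m₀) * X + C (B - m₀ ^ 2) := by
      simp only [cubic, C_sub, C_neg, C_mul, C_pow, map_ofNat C, C_1]
      ring
    rw [this]
    exact leadingCoeff_cubic one_ne_zero
  refine (prod_eq_of_span_eq (W := (curve A B).baseChange K) (monic_prod_X_sub_C x _) (hm.map _)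
    ?_)
  rw [← h.span_mul_conjY, ← Ideal.span_singleton_neg, ← map_neg]
  -- The product of a line with its conjugate is $(m_1x+m_0)^2-y^2$. The sign makes the norm monic,
  -- as needed to compare generators.
  have e : functionOf K A B (-(line m₁ m₀ * TraceZero.conjY (line m₁ m₀))) =
      functionOf K A B (C (cubic A B - (C m₁ * X + C m₀) ^ 2)) := by
    rw [functionOf_eq]
    refine ⟨1, ?_⟩
    rw [← conjHom_apply]
    simp only [line, map_sub, conjHom_Y, conjHom_C, modulus, map_pow]
    ring
  rw [e, functionOf_apply, map_C, coe_mapRingHom]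

theorem evalEval_of_hasDivisor [DecidableEq K] {g : F[X][Y]} {D : ι → Pt K A B} (h : HasDivisor g D)
    {i : ι} {x y : K} {hxy : ((curve A B).baseChange K).Nonsingular x y}
    (hi : D i = Point.some x y hxy) : (g.map (mapRingHom (algebraMap F K))).evalEval x y = 0 := by
  refine evalEval_of_mem hxy.left ?_
  have hle : ∏ i, pointIdeal (D i) ≤ pointIdeal (D i) :=
    Ideal.le_of_dvd (Finset.dvd_prod_of_mem _ (Finset.mem_univ i))
  rw [hi] at hle
  refine hle ?_
  rw [← hasDivisor_iff.mp h]
  exact Ideal.mem_span_singleton_self _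

end Divisors

/-! ## Frobenius orbits -/

section Orbits

open WeierstrassCurve.Affine WeierstrassCurve.Affine.CoordinateRing

variable {F : Type*} [Field F] {K : Type*} [Field K] [Algebra F K] {A B : F}

theorem HasDivisor.comp_perm {ι : Type*} [Fintype ι] {g : F[X][Y]} {D : ι → Pt K A B}
    (σ : Equiv.Perm ι) : HasDivisor g (D ∘ σ) ↔ HasDivisor g D := by
  rw [hasDivisor_iff, hasDivisor_iff, ← Equiv.prod_comp σ fun i => pointIdeal (D i)]
  rfl

theorem line_eq_normal_form (m₁ m₀ : F) :
    line m₁ m₀ = C (C (-m₁) * X + C (-m₀)) + Y * C 1 := by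
  simp only [line, C_neg, C_add, C_mul, C_1]
  ring

theorem line_unique {ι : Type*} [Fintype ι] {D : ι → Pt K A B} {m₁ m₀ n₁ n₀ : F}
    (h : HasDivisor (line m₁ m₀) D) (h' : HasDivisor (line n₁ n₀) D) : m₁ = n₁ ∧ m₀ = n₀ := by
  obtain ⟨κ, -, hκ⟩ := h.exists_const h'
  have e : C (C κ) * line n₁ n₀ = C (C κ * (C (-n₁) * X + C (-n₀))) + Y * C (C κ) := by
    rw [line_eq_normal_form, C_mul, C_1]
    ring
  rw [e, line_eq_normal_form, modulus_dvd_normal_form] at hκ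
  obtain ⟨h₁, h₂⟩ := hκ
  rw [← h₂, one_mul] at h₁
  have k₀ := congrArg (coeff · 0) h₁
  have k₁ := congrArg (coeff · 1) h₁
  simp at k₀ k₁
  exact ⟨k₁, k₀⟩

variable [Fintype F] [DecidableEq K]

theorem frob_iterate_some {x y : K} (h : ((curve A B).baseChange K).Nonsingular x y) (n : ℕ) :
    ∃ h', frob^[n] (Point.some x y h : Pt K A B) =
      Point.some ((FiniteField.frobeniusAlgHom F K)^[n] x)
        ((FiniteField.frobeniusAlgHom F K)^[n] y) h' := by
  induction n with
  | zero => exact ⟨h, rfl⟩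
  | succ n ih =>
    obtain ⟨h', e⟩ := ih
    simp only [Function.iterate_succ_apply', e]
    exact ⟨((curve A B).baseChange_nonsingular
      (FiniteField.frobeniusAlgHom F K).injective ..).mpr h', rfl⟩

theorem frob_iterate_finrank [FiniteDimensional F K] (P : Pt K A B) :
    frob^[Module.finrank F K] P = P := by
  have : Finite K := Module.finite_of_finite F
  rcases P with _ | ⟨x, y, h⟩
  · exact iterate_map_zero frob _
  · obtain ⟨h', e⟩ := frob_iterate_some h (Module.finrank F K)
    have hf (z : K) : (FiniteField.frobeniusAlgHom F K)^[Module.finrank F K] z = z := by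
      rw [← AlgHom.coe_pow, ← FiniteField.orderOf_frobeniusAlgHom F K, pow_orderOf_eq_one]
      rfl
    rw [e]
    exact (Point.some.injEq ..).mpr ⟨hf x, hf y⟩

theorem frob_iterate_ne_zero {P : Pt K A B} (hP : P ≠ 0) (n : ℕ) : frob^[n] P ≠ 0 := by
  rcases P with _ | ⟨x, y, h⟩
  · exact absurd rfl hP
  · obtain ⟨h', e⟩ := frob_iterate_some h n
    rw [e]
    exact Point.some_ne_zero h'

theorem exists_coords {P : Pt K A B} (hP : P ≠ 0) :
    ∃ (x y : Fin 3 → K) (h : ∀ i, ((curve A B).baseChange K).Nonsingular (x i) (y i)),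
      orbit P = fun i => Point.some (x i) (y i) (h i) := by
  have h (i : Fin 3) : ∃ (x y : K) (h : ((curve A B).baseChange K).Nonsingular x y),
      orbit P i = Point.some x y h := by
    have h0 : orbit P i ≠ 0 := frob_iterate_ne_zero hP i
    rcases e : orbit P i with _ | ⟨x, y, h⟩
    · exact absurd e h0
    · exact ⟨x, y, h, rfl⟩
  choose x y hxy e using h
  exact ⟨x, y, hxy, funext e⟩

theorem orbit_two_nsmul (P : Pt K A B) : orbit (2 • P) = fun i => 2 • orbit P i := by
  funext i
  exact iterate_map_nsmul (frob : Pt K A B →+ Pt K A B) i P 2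

/-- The points of the orbit of `P` are the intersections of the line with the curve. -/
structure OrbitCoords (P : Pt K A B) (m₁ m₀ : F) (x y : Fin 3 → K) : Prop where
  nonsingular : ∀ i, ((curve A B).baseChange K).Nonsingular (x i) (y i)
  orbit_eq : orbit P = fun i => Point.some (x i) (y i) (nonsingular i)
  y_eq : ∀ i, y i = algebraMap F K m₁ * x i + algebraMap F K m₀
  elemSymm_eq : elemSymm x =
    fun i => algebraMap F K (![m₁ ^ 2, A - 2 * m₀ * m₁, m₀ ^ 2 - B] i)
  prod_eq : ∀ z, ∏ i, (z - x i) = z ^ 3 + algebraMap F K A * z + algebraMap F K B -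
    (algebraMap F K m₁ * z + algebraMap F K m₀) ^ 2

theorem IsLineOf.exists_orbitCoords {P : Pt K A B} {m₁ m₀ : F} (h : IsLineOf P m₁ m₀) (hP : P ≠ 0) :
    ∃ x y, OrbitCoords P m₁ m₀ x y := by
  obtain ⟨x, y, hxy, e⟩ := exists_coords hP
  have h' : HasDivisor (line m₁ m₀) fun i => (Point.some (x i) (y i) (hxy i) : Pt K A B) := e ▸ h
  have key := prod_of_hasDivisor_line h'
  refine ⟨x, y, hxy, e, fun i => ?_, ?_, fun z => ?_⟩
  · have := evalEval_of_hasDivisor h' (i := i) rfl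
    simp [line, evalEval_C] at this
    linear_combination this
  · have e₁ : ∏ i, (X - C (x i)) = C 1 * X ^ 3 + C (-elemSymm x 0) * X ^ 2 + C (elemSymm x 1) * X
        + C (-elemSymm x 2) := by
      simp only [Fin.prod_univ_three, elemSymm, Matrix.cons_val, C_neg, C_add, C_mul, C_1]
      ring
    have e₂ : (cubic A B - (C m₁ * X + C m₀) ^ 2).map (algebraMap F K) =
        C 1 * X ^ 3 + C (-algebraMap F K (m₁ ^ 2)) * X ^ 2
          + C (algebraMap F K (A - 2 * m₀ * m₁)) * X + C (-algebraMap F K (m₀ ^ 2 - B)) := by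
      simp only [cubic, Polynomial.map_sub, Polynomial.map_add, Polynomial.map_mul,
        Polynomial.map_pow, map_X, map_C, map_sub, map_mul, map_pow, map_ofNat, C_1, C_neg]
      ring
    rw [e₁, e₂] at key
    have k₀ := congrArg (coeff · 0) key
    have k₁ := congrArg (coeff · 1) key
    have k₂ := congrArg (coeff · 2) key
    simp only [coeff_add, coeff_C_mul, coeff_X_pow, coeff_X, coeff_C] at k₀ k₁ k₂
    norm_num at k₀ k₁ k₂
    funext i
    fin_cases i
    · simpa using k₂
    · simpa using k₁
    · simp only [Fin.reduceFinMk, Matrix.cons_val, map_sub, map_pow]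
      linear_combination -k₀
  · have := congrArg (eval z) key
    rw [eval_prod] at this
    simpa [cubic] using this

/-- At such a point $\prod_i(u-x_i)=f(u)-(m_1u+m_0)^2=v^2-v^2=0$, so $u$ is some $x_i$. The line
then fixes the ordinate. -/
theorem OrbitCoords.mem_orbit {P : Pt K A B} {m₁ m₀ : F} {x y : Fin 3 → K}
    (h : OrbitCoords P m₁ m₀ x y) {u v : K} (huv : ((curve A B).baseChange K).Nonsingular u v)
    (hv : v = algebraMap F K m₁ * u + algebraMap F K m₀) : ∃ i, Point.some u v huv = orbit P i := by
  have := h.prod_eq u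
  rw [← equation_baseChange.mp huv.left, ← hv, sub_self, Finset.prod_eq_zero_iff] at this
  obtain ⟨i, -, hi⟩ := this
  refine ⟨i, ?_⟩
  rw [h.orbit_eq]
  have hu := sub_eq_zero.mp hi
  exact (Point.some.injEq ..).mpr ⟨hu, by rw [hv, h.y_eq, hu]⟩

theorem orbit_eq_comp (hK : Module.finrank F K = 3) {P Q : Pt K A B} {i j : Fin 3}
    (h : orbit Q j = orbit P i) : ∃ σ : Equiv.Perm (Fin 3), orbit Q = orbit P ∘ σ := by
  have : FiniteDimensional F K := Module.finite_of_finrank_eq_succ hK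
  have h3 (P : Pt K A B) (n : ℕ) : frob^[3 * n] P = P := by
    rw [Function.iterate_mul]
    exact Function.iterate_fixed (hK ▸ frob_iterate_finrank P) n
  have hmod (P : Pt K A B) (n : ℕ) : frob^[n % 3] P = frob^[n] P := by
    conv_rhs => rw [← Nat.mod_add_div n 3, Function.iterate_add_apply, h3]
  -- Since $\varphi^3=1$ on $E(K)$, a common point makes the two orbits cyclic shifts of each other.
  refine ⟨Equiv.addRight (i - j), funext fun l => ?_⟩
  have e : l = (l - j) + j := (sub_add_cancel l j).symm
  have hadd (P : Pt K A B) (a b : Fin 3) : orbit P (a + b) = frob^[a] (orbit P b) := by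
    unfold orbit
    rw [Fin.val_add, hmod, Function.iterate_add_apply]
  have hs : ∀ i j l : Fin 3, l - j + i = l + (i - j) := by decide
  have e' : orbit Q l = orbit Q (l - j + j) := congrArg _ e
  rw [e', hadd, h, ← hadd, hs]
  rfl

end Orbits

/-! ## The divisors of the formulas -/

section Formulas

open WeierstrassCurve.Affine WeierstrassCurve.Affine.CoordinateRing

variable {F : Type*} [Field F] {K : Type*} [Field K] [Algebra F K]

/-- Evaluate the variables `x_{P_i}, y_{P_i}, x_{Q_i}, y_{Q_i}` at the coordinates of points. -/
noncomputable def evalPoints (F : Type*) [Field F] [Algebra F K] (x y x' y' : Fin 3 → K) :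
    MvPolynomial Var F →ₐ[F] K[X][Y] :=
  MvPolynomial.aeval fun
    | .xP i => C (C (x i))
    | .yP i => C (C (y i))
    | .xQ i => C (C (x' i))
    | .yQ i => C (C (y' i))
    | .x => C X
    | .y => Y

section EvalPoints

variable {x y x' y' : Fin 3 → K}

theorem evalPoints_xP (i : Fin 3) : evalPoints F x y x' y' (var (.xP i)) = C (C (x i)) :=
  MvPolynomial.aeval_X _ _

theorem evalPoints_yP (i : Fin 3) : evalPoints F x y x' y' (var (.yP i)) = C (C (y i)) :=
  MvPolynomial.aeval_X _ _

theorem evalPoints_xQ (i : Fin 3) : evalPoints F x y x' y' (var (.xQ i)) = C (C (x' i)) :=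
  MvPolynomial.aeval_X _ _

theorem evalPoints_yQ (i : Fin 3) : evalPoints F x y x' y' (var (.yQ i)) = C (C (y' i)) :=
  MvPolynomial.aeval_X _ _

theorem evalPoints_x : evalPoints F x y x' y' (var .x) = C X := MvPolynomial.aeval_X _ _

theorem evalPoints_y : evalPoints F x y x' y' (var .y) = Y := MvPolynomial.aeval_X _ _

theorem evalPoints_C (a : F) : evalPoints F x y x' y' (.C a) = C (C (algebraMap F K a)) :=
  MvPolynomial.algHom_C _ _

end EvalPoints

variable {D : LinePair F}

/-- Coordinates of actual points satisfy every relation that the procedure imposes formally, so its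
output specialises to the product of the genuine tangents or chords. -/
theorem evalPoints_output {x y x' y' : Fin 3 → K}
    (hy : ∀ i, y i = algebraMap F K D.α₁ * x i + algebraMap F K D.α₀)
    (hy' : ∀ i, y' i = algebraMap F K D.β₁ * x' i + algebraMap F K D.β₀)
    (hx : elemSymm x = fun i => algebraMap F K (valueE D i))
    (hx' : elemSymm x' = fun i => algebraMap F K (valueS D i))
    {p : MvPolynomial Var F} {t : F[X][Y]} (h : IsOutput D p t) :
    t.map (mapRingHom (algebraMap F K)) = evalPoints F x y x' y' p := by
  obtain ⟨g, hg, rfl⟩ := h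
  have h₁ : (evalPoints F x y x' y').comp (substY D) = evalPoints F x y x' y' := by
    ext v : 1
    rw [AlgHom.comp_apply]
    rcases v with i | i | i | i | _ | _
    · exact congrArg _ (substY_xP D i)
    · refine (congrArg _ (substY_yP D i)).trans ?_
      rw [map_add, map_mul, evalPoints_C, evalPoints_C, evalPoints_xP]
      refine Eq.trans ?_ (evalPoints_yP i).symm
      rw [hy, C_add, C_mul, C_add, C_mul]
    · exact congrArg _ (substY_xQ D i)
    · refine (congrArg _ (substY_yQ D i)).trans ?_
      rw [map_add, map_mul, evalPoints_C, evalPoints_C, evalPoints_xQ]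
      refine Eq.trans ?_ (evalPoints_yQ i).symm
      rw [hy', C_add, C_mul, C_add, C_mul]
    · exact congrArg _ (substY_x D)
    · exact congrArg _ (substY_y D)
  have h₂ : (mapRingHom (mapRingHom (algebraMap F K))).comp (substES D).toRingHom =
      ((evalPoints F x y x' y').comp (expand F)).toRingHom := by
    refine MvPolynomial.ringHom_ext (fun a => ?_) fun v => ?_
    · simp [MvPolynomial.algHom_C, substES, Polynomial.algebraMap_apply]
    · change (substES D (.X v)).map (mapRingHom (algebraMap F K)) =
        evalPoints F x y x' y' (expand F (.X v))
      rcases v with i | i | _ | _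
      · rw [expand_e, map_elemSymm]
        simp only [evalPoints_xP]
        refine Eq.trans ?_ (map_elemSymm (C.comp C : K →+* K[X][Y]) x i)
        rw [hx]
        simp [substES]
      · rw [expand_s, map_elemSymm]
        simp only [evalPoints_xQ]
        refine Eq.trans ?_ (map_elemSymm (C.comp C : K →+* K[X][Y]) x' i)
        rw [hx']
        simp [substES]
      · rw [expand_x, evalPoints_x]
        simp [substES]
      · rw [expand_y, evalPoints_y]
        simp [substES]
  refine (DFunLike.congr_fun h₂ g).trans ?_
  change evalPoints F x y x' y' (expand F g) = _
  rw [hg]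
  exact DFunLike.congr_fun h₁ p

theorem evalPoints_tangent (x y x' y' : Fin 3 → K) (i : Fin 3) :
    evalPoints F x y x' y' (tangent D i) =
      C (C (3 * x i ^ 2 + algebraMap F K D.A)) * C X - C (C (2 * y i)) * Y
        + C (C (2 * y i ^ 2 - (3 * x i ^ 2 + algebraMap F K D.A) * x i)) := by
  simp only [tangent, derivative_cubic, map_add, map_sub, map_mul, map_pow, aeval_X, aeval_C,
    map_ofNat, evalPoints_xP, evalPoints_yP, evalPoints_x, evalPoints_y,
    MvPolynomial.algebraMap_eq, evalPoints_C]

theorem evalPoints_chord (x y x' y' : Fin 3 → K) (i j : Fin 3) :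
    evalPoints F x y x' y' (chord F i j) =
      C (C (y' j - y i)) * C X + C (C (x i - x' j)) * Y
        + C (C ((x' j - x i) * y i + (y i - y' j) * x i)) := by
  simp only [chord, map_add, map_sub, map_mul, evalPoints_xP, evalPoints_yP, evalPoints_xQ,
    evalPoints_yQ, evalPoints_x, evalPoints_y]

theorem functionOf_line_ne_zero (m₁ m₀ : F) (A B : F) : functionOf K A B (line m₁ m₀) ≠ 0 := by
  rw [functionOf_apply, line, Polynomial.map_sub, map_X, map_C]
  exact YClass_ne_zero _

theorem conjY_line (m₁ m₀ : F) : conjY (line m₁ m₀) = -line (-m₁) (-m₀) := by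
  rw [← conjHom_apply, line, line, map_sub, conjHom_Y, conjHom_C]
  simp only [C_neg, C_add, C_mul]
  ring

theorem HasDivisor.of_span_mul {ι : Type*} [Fintype ι] {A B : F} {f g : F[X][Y]}
    {D : ι → Pt K A B} {I : Ideal ((curve A B).baseChange K).CoordinateRing}
    (hf : functionOf K A B f ≠ 0) (hI : Ideal.span {functionOf K A B f} = I)
    (h : Ideal.span {functionOf K A B (f * g)} = I * ∏ i, pointIdeal (D i)) : HasDivisor g D := by
  rw [hasDivisor_iff]
  refine (Ideal.span_singleton_mul_right_inj hf).mp ?_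
  rw [Ideal.span_singleton_mul_span_singleton, ← map_mul, h, hI]

variable [Fintype F] [DecidableEq K]

theorem IsLineOf.hasDivisor_neg {P : Pt K D.A D.B} {m₁ m₀ : F} (h : IsLineOf P m₁ m₀) :
    HasDivisor (line (-m₁) (-m₀)) fun i => -orbit P i := by
  refine (HasDivisor.conjY h).of_modulus_dvd (κ := -1) (neg_ne_zero.mpr one_ne_zero) ?_
  have e : line (-m₁) (-m₀) - C (C (-1)) * -line (-m₁) (-m₀) = 0 := by
    simp only [C_neg, C_1]
    ring
  rw [conjY_line, e]
  exact dvd_zero _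

/-- The ideal of $T$ is computed twice, from the tangents and from `tangentNorm_eq`. Cancelling
$h_P^2$ and conjugating gives the divisor. The point `Q` is present because the data carry both
lines and the evaluation needs values for all variables. -/
theorem hasDivisor_doublingFormula (h2 : ringChar F ≠ 2) {P Q : Pt K D.A D.B} (hP : P ≠ 0)
    (hQ : Q ≠ 0) (h : IsLineOf P D.α₁ D.α₀) (h' : IsLineOf Q D.β₁ D.β₀) :
    HasDivisor (doublingFormula D) (orbit (2 • P)) := by
  obtain ⟨x, y, hx⟩ := h.exists_orbitCoords hP
  obtain ⟨x', y', hx'⟩ := h'.exists_orbitCoords hQ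
  obtain ⟨t, ht, -⟩ := existsUnique_isOutput_tangentProduct D
  have h2K : (2 : K) ≠ 0 := by
    have := (map_ne_zero (algebraMap F K)).mpr (Ring.two_ne_zero h2)
    rwa [map_ofNat] at this
  have hT : Ideal.span {functionOf K D.A D.B t} =
      (∏ i, pointIdeal (orbit P i)) ^ 2 * ∏ i, pointIdeal (-orbit (2 • P) i) := by
    rw [functionOf_apply, evalPoints_output hx.y_eq hx'.y_eq hx.elemSymm_eq hx'.elemSymm_eq ht,
      tangentProduct, map_prod, map_prod, ← Ideal.prod_span_singleton, pow_two,
      ← Finset.prod_mul_distrib, ← Finset.prod_mul_distrib]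
    refine Finset.prod_congr rfl fun i _ => ?_
    rw [evalPoints_tangent, span_tangent h2K (hx.nonsingular i), orbit_two_nsmul, hx.orbit_eq]
  have hd : modulus D.A D.B ∣
      t - C (C (-1)) * (line D.α₁ D.α₀ ^ 2 * conjY (doublingFormula D)) := by
    have := modulus_dvd_conjHom.mpr (modulus_dvd_tangentProduct_output ht)
    rw [map_sub, ← conjHom_apply t, conjHom_conjHom, map_mul, map_mul, map_pow, conjHom_C,
      conjHom_apply (line _ _), conjY_line, neg_neg, neg_neg, conjHom_apply] at this
    have e : (-line D.α₁ D.α₀) ^ 2 = line D.α₁ D.α₀ ^ 2 := by ring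
    rwa [e] at this
  rw [span_functionOf_eq (neg_ne_zero.mpr one_ne_zero) hd] at hT
  have hl : Ideal.span {functionOf K D.A D.B (line D.α₁ D.α₀ ^ 2)} =
      (∏ i, pointIdeal (orbit P i)) ^ 2 := by
    rw [map_pow, ← Ideal.span_singleton_pow]
    exact congrArg (· ^ 2) h
  have key := HasDivisor.of_span_mul (by
    rw [map_pow]; exact pow_ne_zero 2 (functionOf_line_ne_zero _ _ _ _)) hl hT
  have := key.conjY
  simp only [neg_neg] at this
  rwa [← conjHom_apply (doublingFormula D), ← conjHom_apply, conjHom_conjHom] at this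

theorem orbit_disjoint (hK : Module.finrank F K = 3) {P Q : Pt K D.A D.B}
    (h : IsLineOf P D.α₁ D.α₀) (h' : IsLineOf Q D.β₁ D.β₀)
    (hne : ¬(D.α₁ = D.β₁ ∧ D.α₀ = D.β₀)) (i j : Fin 3) : orbit P i ≠ orbit Q j := by
  intro e
  obtain ⟨σ, hσ⟩ := orbit_eq_comp hK e
  rw [IsLineOf, hσ, HasDivisor.comp_perm] at h
  exact hne (line_unique h h')

/-- This constant is $\prod_i h_Q(P_i)$. A zero factor would place some $P_i$ on $h_Q$, hence in the
orbit of $Q$, and orbits with a common point have the same line. -/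
theorem quadNorm_ne_zero (hK : Module.finrank F K = 3) {P Q : Pt K D.A D.B} (hP : P ≠ 0)
    (hQ : Q ≠ 0) (h : IsLineOf P D.α₁ D.α₀) (h' : IsLineOf Q D.β₁ D.β₀)
    (hne : ¬(D.α₁ = D.β₁ ∧ D.α₀ = D.β₀)) :
    quadNorm (valueE D) (D.α₀ - D.β₀) (D.α₁ - D.β₁) 0 ≠ 0 := by
  obtain ⟨x, y, hx⟩ := h.exists_orbitCoords hP
  obtain ⟨x', y', hx'⟩ := h'.exists_orbitCoords hQ
  intro h0
  have h1 := congrArg (algebraMap F K) h0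
  have e : elemSymm x = fun i => algebraMap F K (valueE D i) := hx.elemSymm_eq
  rw [map_quadNorm, ← e, quadNorm_elemSymm, map_zero, Finset.prod_eq_zero_iff] at h1
  obtain ⟨i, -, hi⟩ := h1
  simp only [map_sub, zero_mul, add_zero] at hi
  obtain ⟨j, hj⟩ := hx'.mem_orbit (hx.nonsingular i)
    (by rw [hx.y_eq]; linear_combination hi)
  refine orbit_disjoint hK h h' hne i j ?_
  rw [← hj, hx.orbit_eq]

/-- Different lines make the orbits disjoint, so every $r_{ij}$ is a genuine chord. The two
computations of the ideal of $R$ are then compared as for doubling. -/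
theorem hasDivisor_sumFormula_of_ne (hK : Module.finrank F K = 3) {P Q : Pt K D.A D.B}
    (hP : P ≠ 0) (hQ : Q ≠ 0) (h : IsLineOf P D.α₁ D.α₀) (h' : IsLineOf Q D.β₁ D.β₀)
    (hne : ¬(D.α₁ = D.β₁ ∧ D.α₀ = D.β₀)) : HasDivisor (sumFormula D) (sums P Q) := by
  obtain ⟨x, y, hx⟩ := h.exists_orbitCoords hP
  obtain ⟨x', y', hx'⟩ := h'.exists_orbitCoords hQ
  obtain ⟨r, hr, -⟩ := existsUnique_isOutput_chordProduct D
  have hR : Ideal.span {functionOf K D.A D.B r} =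
      (∏ i, pointIdeal (orbit P i)) ^ 3 * (∏ i, pointIdeal (orbit Q i)) ^ 3 *
        ∏ i, pointIdeal (-sums P Q i) := by
    have e (i j : Fin 3) : Ideal.span {CoordinateRing.mk ((curve D.A D.B).baseChange K)
        (evalPoints F x y x' y' (chord F i j))} =
        pointIdeal (orbit P i) * pointIdeal (orbit Q j) * pointIdeal (-sums P Q (i, j)) := by
      have hij := orbit_disjoint hK h h' hne i j
      rw [sums]
      simp only [hx.orbit_eq, hx'.orbit_eq] at hij ⊢
      rw [evalPoints_chord, span_chord (hx.nonsingular i) (hx'.nonsingular j) hij]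
    rw [functionOf_apply, evalPoints_output hx.y_eq hx'.y_eq hx.elemSymm_eq hx'.elemSymm_eq hr,
      chordProduct]
    simp only [map_prod, ← Ideal.prod_span_singleton, e, Finset.prod_mul_distrib,
      Finset.prod_const, Finset.card_univ, Fintype.card_fin, Finset.prod_pow,
      Fintype.prod_prod_type]
  have hd := modulus_dvd_chordProduct_output hr
  rw [span_functionOf_eq (neg_ne_zero.mpr (quadNorm_ne_zero hK hP hQ h h' hne)) hd] at hR
  have hl : Ideal.span {functionOf K D.A D.B (line D.α₁ D.α₀ ^ 3 * line D.β₁ D.β₀ ^ 3)} =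
      (∏ i, pointIdeal (orbit P i)) ^ 3 * (∏ i, pointIdeal (orbit Q i)) ^ 3 := by
    rw [map_mul, map_pow, map_pow, ← Ideal.span_singleton_mul_span_singleton,
      ← Ideal.span_singleton_pow, ← Ideal.span_singleton_pow]
    exact congrArg₂ (fun I J => I ^ 3 * J ^ 3) h h'
  have key := HasDivisor.of_span_mul (by
    rw [map_mul, map_pow, map_pow]
    exact mul_ne_zero (pow_ne_zero 3 (functionOf_line_ne_zero _ _ _ _))
      (pow_ne_zero 3 (functionOf_line_ne_zero _ _ _ _))) hl hR
  have := key.conjY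
  simp only [neg_neg] at this
  rwa [← conjHom_apply (sumFormula D), ← conjHom_apply, conjHom_conjHom] at this

theorem hasDivisor_sumFormula_of_eq (h2 : ringChar F ≠ 2) (hK : Module.finrank F K = 3)
    {P Q : Pt K D.A D.B} (htr : TraceZeroPoint P) (hP : P ≠ 0) (hQ : Q ≠ 0)
    (h : IsLineOf P D.α₁ D.α₀) (h' : IsLineOf Q D.β₁ D.β₀)
    (h₁ : D.α₁ = D.β₁) (h₀ : D.α₀ = D.β₀) : HasDivisor (sumFormula D) (sums P Q) := by
  obtain ⟨σ, hσ⟩ : ∃ σ : Equiv.Perm (Fin 3), orbit Q = orbit P ∘ σ := by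
    obtain ⟨x, y, hx⟩ := h.exists_orbitCoords hP
    obtain ⟨x', y', hx'⟩ := h'.exists_orbitCoords hQ
    obtain ⟨i, hi⟩ := hx.mem_orbit (hx'.nonsingular 0) (by rw [hx'.y_eq, h₁, h₀])
    refine orbit_eq_comp hK (i := i) (j := 0) ?_
    rw [← hi, hx'.orbit_eq]
  have hs : sums P Q = sums P P ∘ Equiv.prodCongr (Equiv.refl _) σ := by
    funext ij
    simp [sums, hσ]
  rw [hs, HasDivisor.comp_perm, hasDivisor_iff,
    span_functionOf_eq (neg_ne_zero.mpr one_ne_zero) (modulus_dvd_sumFormula_of_eq h₁ h₀),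
    map_mul, map_pow, ← Ideal.span_singleton_mul_span_singleton, ← Ideal.span_singleton_pow,
    hasDivisor_iff.mp h.hasDivisor_neg,
    hasDivisor_iff.mp (hasDivisor_doublingFormula h2 hP hQ h h')]
  -- Trace zero turns the six off-diagonal sums into each $-P_k$ twice, matching $h_{-P}^2$. The
  -- diagonal sums are the orbit of $2P$.
  have h0 : orbit P 0 + orbit P 1 + orbit P 2 = 0 := htr
  simp only [Fintype.prod_prod_type, Fin.prod_univ_three, sums, orbit_two_nsmul]
  simp only [two_nsmul]
  have e₀₁ : orbit P 0 + orbit P 1 = -orbit P 2 := eq_neg_of_add_eq_zero_left h0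
  have e₁₂ : orbit P 1 + orbit P 2 = -orbit P 0 :=
    eq_neg_of_add_eq_zero_right (by rw [← h0]; abel)
  have e₀₂ : orbit P 0 + orbit P 2 = -orbit P 1 :=
    eq_neg_of_add_eq_zero_left (by rw [← h0]; abel)
  rw [add_comm (orbit P 1) (orbit P 0), add_comm (orbit P 2) (orbit P 0),
    add_comm (orbit P 2) (orbit P 1), e₀₁, e₁₂, e₀₂]
  ring

theorem hasDivisor_sumFormula (h2 : ringChar F ≠ 2) (hK : Module.finrank F K = 3)
    {P Q : Pt K D.A D.B} (htr : TraceZeroPoint P) (hP : P ≠ 0) (hQ : Q ≠ 0)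
    (h : IsLineOf P D.α₁ D.α₀) (h' : IsLineOf Q D.β₁ D.β₀) :
    HasDivisor (sumFormula D) (sums P Q) := by
  by_cases e : D.α₁ = D.β₁ ∧ D.α₀ = D.β₀
  · exact hasDivisor_sumFormula_of_eq h2 hK htr hP hQ h h' e.1 e.2
  · exact hasDivisor_sumFormula_of_ne hK hP hQ h h' e

end Formulas

/-! ## Correctness of the procedure -/

section Correctness

open WeierstrassCurve.Affine WeierstrassCurve.Affine.CoordinateRing

variable {F : Type*} [Field F] {D : LinePair F}

theorem functionOf_const_mul_inv {K : Type*} [Field K] [Algebra F K] {A B κ : F} (hκ : κ ≠ 0) :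
    functionOf K A B (C (C κ)) * functionOf K A B (C (C κ⁻¹)) = 1 := by
  rw [← map_mul, ← C_mul, ← C_mul, mul_inv_cancel₀ hκ, C_1, C_1, map_one]

theorem eqUpToConst_mul_iff {f p g g₀ : F[X][Y]} {κ₀ : F} (hf : functionOf F D.A D.B f ≠ 0)
    (hκ₀ : κ₀ ≠ 0) (h : modulus D.A D.B ∣ p - C (C κ₀) * (f * g₀)) :
    EqUpToConst D p (f * g) ↔ ∃ κ : F, κ ≠ 0 ∧ modulus D.A D.B ∣ g - C (C κ) * g₀ := by
  simp only [EqUpToConst, ← functionOf_eq (K := F), map_mul] at h ⊢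
  constructor
  · rintro ⟨κ, hκ, e⟩
    refine ⟨κ⁻¹ * κ₀, mul_ne_zero (inv_ne_zero hκ) hκ₀, mul_left_cancel₀ hf ?_⟩
    rw [C_mul, C_mul, map_mul]
    linear_combination functionOf F D.A D.B (C (C κ⁻¹)) * (h - e) -
      functionOf F D.A D.B f * functionOf F D.A D.B g *
        functionOf_const_mul_inv (K := F) (A := D.A) (B := D.B) hκ
  · rintro ⟨κ, hκ, e⟩
    refine ⟨κ₀ * κ⁻¹, mul_ne_zero hκ₀ (inv_ne_zero hκ), ?_⟩
    rw [C_mul, C_mul, map_mul]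
    linear_combination h - functionOf F D.A D.B (C (C κ₀)) * functionOf F D.A D.B (C (C κ⁻¹)) *
      functionOf F D.A D.B f * e - functionOf F D.A D.B (C (C κ₀)) *
        functionOf F D.A D.B f * functionOf F D.A D.B g₀ *
          functionOf_const_mul_inv (K := F) (A := D.A) (B := D.B) hκ

theorem modulus_dvd_conjY_sub {A B κ : F} {g g₀ : F[X][Y]} :
    modulus A B ∣ conjY g - C (C κ) * conjY g₀ ↔ modulus A B ∣ g - C (C κ) * g₀ := by
  rw [← modulus_dvd_conjHom (g := g - _), map_sub, map_mul, conjHom_C, conjHom_apply,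
    conjHom_apply]

theorem modulus_dvd_sumFormula_iff {κ : F} {s₁ s₂ : F[X]} :
    modulus D.A D.B ∣ C s₁ + Y * C s₂ - C (C κ) * sumFormula D ↔
      s₁ = C κ * sumPart₁ D ∧ s₂ = C κ * sumPart₂ D := by
  rw [← modulus_dvd_normal_form (A := D.A) (B := D.B), sumFormula, C_mul, C_mul]
  refine iff_of_eq (congrArg _ ?_)
  ring

theorem modulus_dvd_doublingFormula_iff {κ d v₀ v₁ : F} :
    modulus D.A D.B ∣ C (C d) * Y - C (C v₀ + C v₁ * X) - C (C κ) * doublingFormula D ↔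
      d = κ * c D ∧ v₀ = κ * u₀ D ∧ v₁ = κ * u₁ D := by
  have e : C (C d) * Y - C (C v₀ + C v₁ * X) - C (C κ) * doublingFormula D =
      C (-(C v₀ + C v₁ * X)) + Y * C (C d) -
        (C (-(C (κ * u₀ D) + C (κ * u₁ D) * X)) + Y * C (C (κ * c D))) := by
    simp only [doublingFormula, C_mul, C_add, C_neg]
    ring
  rw [e, modulus_dvd_normal_form]
  constructor
  · rintro ⟨h, hc⟩
    have h₀ := congrArg (coeff · 0) h
    have h₁ := congrArg (coeff · 1) h
    simp [coeff_C] at h₀ h₁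
    exact ⟨C_injective hc, h₀, h₁⟩
  · rintro ⟨rfl, rfl, rfl⟩
    exact ⟨rfl, rfl⟩

variable {K : Type*} [Field K] [Algebra F K]

/-- With $c=0$ the product of the function with its conjugate is the square of a polynomial in $x$,
of even degree. Three finite zeros would make that degree $3$. -/
theorem c_ne_zero [DecidableEq K] {x y : Fin 3 → K}
    {hxy : ∀ i, ((curve D.A D.B).baseChange K).Nonsingular (x i) (y i)}
    (h : HasDivisor (doublingFormula D)
      fun i => (Point.some (x i) (y i) (hxy i) : Pt K D.A D.B)) : c D ≠ 0 := by
  intro hc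
  have key := h.span_mul_conjY
  have e : doublingFormula D * conjY (doublingFormula D) = C ((C (u₀ D) + C (u₁ D) * X) ^ 2) := by
    rw [← conjHom_apply, doublingFormula, hc, C_0, C_0, zero_mul, zero_sub, map_neg, conjHom_C,
      C_pow]
    ring
  rw [e, functionOf_apply, map_C] at key
  obtain ⟨h₁, h₂⟩ := dvd_dvd_iff_associated.mpr (Ideal.span_singleton_eq_span_singleton.mp key)
  have hdeg := natDegree_eq_of_degree_eq (degree_eq_degree_of_associated
    (associated_of_dvd_dvd (mk_C_dvd_mk_C h₁) (mk_C_dvd_mk_C h₂)))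
  rw [natDegree_finsetProd_X_sub_C_eq_card, map_pow, natDegree_pow, Finset.card_univ,
    Fintype.card_fin] at hdeg
  omega

theorem quadNorm_symbolic_ne_zero (A B : F) :
    quadNorm (valueE (symbolic A B)) ((symbolic A B).α₀ - (symbolic A B).β₀)
      ((symbolic A B).α₁ - (symbolic A B).β₁) 0 ≠ 0 := by
  intro h
  -- At $\alpha_1=\beta_1=\beta_0=0$, $\alpha_0=1$ every factor of the norm is $1$.
  have := congrArg (MvPolynomial.eval ![0, 1, 0, 0]) h
  rw [map_quadNorm] at this
  simp [symbolic, quadNorm] at this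

end Correctness

end TraceZero

theorem mainTheorem6
    {F K : Type*} [Field F] [Fintype F] [Field K] [DecidableEq K] [Algebra F K]
    (hK : Module.finrank F K = 3) (h2 : ringChar F ≠ 2) (h3 : ringChar F ≠ 3)
    (A B : F) (hE : (cubic A B).Separable) :
    -- The procedure, run with indeterminate line coefficients, yields the formulas.
    ((∃! t, IsOutput (symbolic A B) (tangentProduct (symbolic A B)) t) ∧
      (∃! r, IsOutput (symbolic A B) (chordProduct _) r) ∧
      (∀ t, IsOutput (symbolic A B) (tangentProduct (symbolic A B)) t →
        EqUpToConst (symbolic A B) (conjY t)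
          (line (-(symbolic A B).α₁) (-(symbolic A B).α₀) ^ 2 *
            doublingFormula (symbolic A B))) ∧
      (∀ r, IsOutput (symbolic A B) (chordProduct _) r →
        EqUpToConst (symbolic A B) r
          (line (symbolic A B).α₁ (symbolic A B).α₀ ^ 3 *
            line (symbolic A B).β₁ (symbolic A B).β₀ ^ 3 *
            conjY (sumFormula (symbolic A B))))) ∧
    -- For all nonzero points `P, Q` of trace zero:
    ∀ P Q : Pt K A B, TraceZeroPoint P → TraceZeroPoint Q →
      P ≠ 0 → Q ≠ 0 → ∀ D : LinePair F, D.A = A → D.B = B →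
      IsLineOf P D.α₁ D.α₀ → IsLineOf Q D.β₁ D.β₀ →
      -- the procedure, run on the coefficients of `h_P` and `h_Q`, recovers exactly `h_{2P}`
      ((∃! t, IsOutput D (tangentProduct D) t) ∧
        ∀ t, IsOutput D (tangentProduct D) t → ∀ g : F[X][Y],
          (EqUpToConst D (conjY t) (line (-D.α₁) (-D.α₀) ^ 2 * g) ↔
            HasDivisor g (orbit (2 • P)))) ∧
      -- and exactly `S_{P,Q}`, if `h_P ≠ h_Q`;
      ((∃! r, IsOutput D (chordProduct F) r) ∧
        ∀ r, IsOutput D (chordProduct F) r → ¬ (D.α₁ = D.β₁ ∧ D.α₀ = D.β₀) →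
          ∀ g : F[X][Y],
          (EqUpToConst D r (line D.α₁ D.α₀ ^ 3 * line D.β₁ D.β₀ ^ 3 * conjY g) ↔
            HasDivisor g (sums P Q))) ∧
      -- the formulas give the coefficients of `S_{P,Q}`, up to a nonzero constant, in all cases;
      (∀ s₁ s₂ : F[X], HasDivisor (C s₁ + Y * C s₂) (sums P Q) ↔
        ∃ κ : F, κ ≠ 0 ∧ s₁ = C κ * sumPart₁ D ∧ s₂ = C κ * sumPart₂ D) ∧
      -- the formulas give the coefficients of `h_{2P}`, up to a nonzero constant, in all cases,
      (∀ d v₀ v₁ : F,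
        HasDivisor (C (C d) * Y - C (C v₀ + C v₁ * X)) (orbit (2 • P)) ↔
          ∃ κ : F, κ ≠ 0 ∧ d = κ * c D ∧ v₀ = κ * u₀ D ∧ v₁ = κ * u₁ D) ∧
      -- so that `h_{2P} = y - (u₁/c x + u₀/c)` whenever `2P` is not the point at infinity.
      (2 • P ≠ 0 → c D ≠ 0 ∧ ∀ γ₁ γ₀ : F, IsLineOf (2 • P) γ₁ γ₀ ↔
        γ₁ = u₁ D / c D ∧ γ₀ = u₀ D / c D) := by
  refine ⟨⟨existsUnique_isOutput_tangentProduct _, existsUnique_isOutput_chordProduct _,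
    fun t ht => ⟨-1, neg_ne_zero.mpr one_ne_zero, modulus_dvd_tangentProduct_output ht⟩,
    fun r hr => ⟨_, neg_ne_zero.mpr (quadNorm_symbolic_ne_zero A B),
      modulus_dvd_chordProduct_output hr⟩⟩, ?_⟩
  intro P Q hPtr _ hP hQ D hA hB h h'
  subst hA hB
  have hdbl := hasDivisor_doublingFormula h2 hP hQ h h'
  have hdbl_iff (d v₀ v₁ : F) :
      HasDivisor (C (C d) * Y - C (C v₀ + C v₁ * X)) (orbit (2 • P)) ↔
        ∃ κ : F, κ ≠ 0 ∧ d = κ * c D ∧ v₀ = κ * u₀ D ∧ v₁ = κ * u₁ D := by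
    simp only [hdbl.iff_exists_const, modulus_dvd_doublingFormula_iff]
  refine ⟨⟨existsUnique_isOutput_tangentProduct _, fun t ht g => ?_⟩,
    ⟨existsUnique_isOutput_chordProduct _, fun r hr hne g => ?_⟩, fun s₁ s₂ => ?_, hdbl_iff,
    fun h2P => ?_⟩
  · rw [hdbl.iff_exists_const]
    refine eqUpToConst_mul_iff ?_ (neg_ne_zero.mpr one_ne_zero)
      (modulus_dvd_tangentProduct_output ht)
    rw [map_pow]
    exact pow_ne_zero 2 (functionOf_line_ne_zero _ _ _ _)
  · rw [(hasDivisor_sumFormula h2 hK hPtr hP hQ h h').iff_exists_const]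
    refine (eqUpToConst_mul_iff ?_ (neg_ne_zero.mpr (quadNorm_ne_zero hK hP hQ h h' hne))
      (modulus_dvd_chordProduct_output hr)).trans ?_
    on_goal 2 => simp only [modulus_dvd_conjY_sub]
    rw [map_mul, map_pow, map_pow]
    exact mul_ne_zero (pow_ne_zero 3 (functionOf_line_ne_zero _ _ _ _))
      (pow_ne_zero 3 (functionOf_line_ne_zero _ _ _ _))
  · simp only [(hasDivisor_sumFormula h2 hK hPtr hP hQ h h').iff_exists_const,
      modulus_dvd_sumFormula_iff]
  · obtain ⟨x, y, hxy, e⟩ := exists_coords h2P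
    have hc : c D ≠ 0 := c_ne_zero (e ▸ hdbl)
    refine ⟨hc, fun γ₁ γ₀ => ?_⟩
    have hl : line γ₁ γ₀ = C (C 1) * Y - C (C γ₀ + C γ₁ * X) := by
      rw [line, C_1, C_1, one_mul, add_comm]
    rw [IsLineOf, hl, hdbl_iff]
    constructor
    · rintro ⟨κ, -, h₁, rfl, rfl⟩
      -- The coefficient of $y$ in the line is $1$, which fixes the constant.
      obtain rfl : κ = (c D)⁻¹ := eq_inv_of_mul_eq_one_left h₁.symm
      exact ⟨inv_mul_eq_div .., inv_mul_eq_div ..⟩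
    · rintro ⟨rfl, rfl⟩
      exact ⟨(c D)⁻¹, inv_ne_zero hc, (inv_mul_cancel₀ hc).symm, (inv_mul_eq_div ..).symm,
        (inv_mul_eq_div ..).symm⟩
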